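/- **Setting.** Let $1\le I\le K-1$ be integers, $\mathcal Y=\{1,\dots,K\}$, $\mathcal X$ a measurable space and $P$ a probability distribution on $\mathcal X\times\mathcal Y$ (the law of an instance $X$ and the class $Z$ that the annotator considers correct for it). The which-one-type Q&A label $\widetilde Y$ of $X$ is generated as follows: a question set $Q$ is drawn uniformly from the $I$-element subsets of $\mathcal Y$, independently of $(X,Z)$; $\widetilde Y=\{Z\}$ if $Z\in Q$, and $\widetilde Y=\mathcal Y\setminus Q$ if $Z\notin Q$. Let $\widetilde P_I$ be the law of $(X,\widetilde Y)$. Let $\mathcal F$ be a set of measurable functions $f:\mathcal X\to\mathbb R^K$ that is pointwise measurable (it has a countable subset $\mathcal F_0$ such that each $f\in\mathcal F$ is the pointwise limit of a sequence in $\mathcal F_0$; this guarantees that the suprema over $\mathcal F$ are measurable), and let $\mathcal G_y=\{x\mapsto f(x)_y : f\in\mathcal F\}$ for $y\in\mathcal Y$. Let $\mathcal L:\mathbb R^K\times\mathcal Y\to[0,\infty)$ be a loss function, $R(f)=\mathbb E_{P}[\mathcal L(f(X),Z)]$ the classification risk, $$\widetilde{\mathcal L}_I(v,\tilde y)=\sum_{y\in\tilde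 y}\mathcal L(v,y)-\frac{(K-I)(K-I-1)}{I(2K-I-1)}\sum_{y\notin\tilde y}\mathcal L(v,y),$$ and $\widehat R(f)=\frac1n\sum_{i=1}^n\widetilde{\mathcal L}_I(f(x_i),\tilde y_i)$ for a sample $(x_i,\tilde y_i)_{i=1}^n$ drawn i.i.d. from $\widetilde P_I$. Assume that for every $\tilde y\subset\mathcal Y$ with $|\tilde y|\in\{1,K-I\}$ the function $\widetilde{\mathcal L}_I(\cdot,\tilde y)$ is Lipschitz with constant $\rho$ with respect to the Euclidean norm on $\mathbb R^K$. Let $C_L=\sup_{x\in\mathcal X,\,f\in\mathcal F,\,y\in\mathcal Y}\mathcal L(f(x),y)\in[0,\infty]$, and for a set $\mathcal H$ of real-valued functions on $\mathcal X$ let $$\mathfrak R_n(\mathcal H)=\mathbb E_{x_1,\dots,x_n}\mathbb E_\sigma\Big[\sup_{h\in\mathcal H}\frac1n\sum_{i=1}^n\sigma_ih(x_i)\Big]\in[0,\infty]$$ be its Rademacher complexity, where the $x_i$ are i.i.d. with the law of $X$ and the $\sigma_i$ are independent and uniform on $\{-1,1\}$. Let $f^*\in\mathcal F$ minimize $R$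 over $\mathcal F$. **Theorem.** (1) For all $n\ge1$ and $\delta>0$, with probability at least $1-\delta$ over the sample, every minimizer $\hat f$ of $\widehat R$ over $\mathcal F$ satisfies $$R(\hat f)-R(f^*)\le\frac{4\sqrt2\,\rho K^2(K-1)}{I(2K-I-1)}\sum_{y\in\mathcal Y}\mathfrak R_n(\mathcal G_y)+\frac{(K-I)\big(K^2+(I-2)K-I^2+1\big)}{I(2K-I-1)}\,C_L\sqrt{\frac{2\log(2/\delta)}{n}}.$$ (2) Let $\mathbb H$ be a real Hilbert space (for instance a reproducing kernel Hilbert space over $\mathcal X$), $\Phi:\mathcal X\to\mathbb H$ a feature map, $k(x,x')=\langle\Phi(x),\Phi(x')\rangle$ its kernel, $r\ge0$ with $r^2=\sup_xk(x,x)<\infty$, and $\Lambda\ge0$. If $\mathcal G_y=\{x\mapsto\langle w,\Phi(x)\rangle:\|w\|\le\Lambda\}$ for every $y\in\mathcal Y$, then $\mathfrak R_n(\mathcal G_y)\le r\Lambda/\sqrt n$ for all $n\ge1$ and $y\in\mathcal Y$, and learning is statistically consistent: for every $\varepsilon>0$, the probability that some minimizer $\hat f$ of $\widehat R$ over $\mathcal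 F$, for a sample of size $n$, has $|R(\hat f)-R(f^*)|\ge\varepsilon$ tends to $0$ as $n\to\infty$. -/

import Mathlib

open MeasureTheory ProbabilityTheory Filter Topology
open scoped NNReal ENNReal

namespace WhichOne

noncomputable section

/-- The which-one-type Q&A label: the annotator, who considers `z` to be the correct class,
is shown the question class set `q`. If `z ∈ q`, the label is `{z}`; otherwise it is the
complement of `q`. -/
def qaLabel {K : ℕ} (z : Fin K) (q : Finset (Fin K)) : Finset (Fin K) :=
  if z ∈ q then {z} else qᶜ

/-- The joint law of an instance and its which-one-type Q&A label. The pair (instance, class) has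
law `P`; the question class set is uniformly distributed over the `I`-element sets of classes and
independent of that pair. -/
def qaLaw {𝒳 : Type*} [MeasurableSpace 𝒳] {K : ℕ} (P : Measure (𝒳 × Fin K)) (I : ℕ) :
    Measure (𝒳 × Finset (Fin K)) :=
  (P.prod (uniformOn {q : Finset (Fin K) | q.card = I})).map
    (fun t => (t.1.1, qaLabel t.1.2 t.2))

/-- The law of `n` i.i.d. Q&A-labelled samples. -/
def sampleLaw {𝒳 : Type*} [MeasurableSpace 𝒳] {K : ℕ} (P : Measure (𝒳 × Fin K)) (I n : ℕ) :
    Measure (Fin n → 𝒳 × Finset (Fin K)) :=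
  Measure.pi (fun _ : Fin n => qaLaw P I)

/-- The loss on Q&A labels that is induced by a loss `L` on ordinary labels:
`∑_{y ∈ s} L(v, y) - (K-I)(K-I-1) / (I(2K-I-1)) * ∑_{y ∉ s} L(v, y)`. -/
def qaLoss {K : ℕ} (I : ℕ) (L : EuclideanSpace ℝ (Fin K) → Fin K → ℝ)
    (v : EuclideanSpace ℝ (Fin K)) (s : Finset (Fin K)) : ℝ :=
  ∑ y ∈ s, L v y
    - ((K : ℝ) - I) * ((K : ℝ) - I - 1) / ((I : ℝ) * (2 * (K : ℝ) - I - 1)) * ∑ y ∈ sᶜ, L v y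

/-- The classification risk, with respect to ordinary labels. -/
def risk {𝒳 : Type*} [MeasurableSpace 𝒳] {K : ℕ} (P : Measure (𝒳 × Fin K))
    (L : EuclideanSpace ℝ (Fin K) → Fin K → ℝ) (f : 𝒳 → EuclideanSpace ℝ (Fin K)) : ℝ :=
  ∫ p, L (f p.1) p.2 ∂P

/-- The empirical classification risk on Q&A-labelled samples. -/
def empRisk {𝒳 : Type*} {K : ℕ} (I : ℕ) (L : EuclideanSpace ℝ (Fin K) → Fin K → ℝ) {n : ℕ}
    (S : Fin n → 𝒳 × Finset (Fin K)) (f : 𝒳 → EuclideanSpace ℝ (Fin K)) : ℝ :=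
  (1 / (n : ℝ)) * ∑ i, qaLoss I L (f (S i).1) (S i).2

/-- `f` is an empirical risk minimizer over the class `F` on the sample `S`. -/
def IsERM {𝒳 : Type*} {K : ℕ} (I : ℕ) (L : EuclideanSpace ℝ (Fin K) → Fin K → ℝ)
    (F : Set (𝒳 → EuclideanSpace ℝ (Fin K))) {n : ℕ}
    (S : Fin n → 𝒳 × Finset (Fin K)) (f : 𝒳 → EuclideanSpace ℝ (Fin K)) : Prop :=
  f ∈ F ∧ IsMinOn (empRisk I L S) F f

/-- The set of discriminant functions of class `y`: a hypothesis `f` is the vector of its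
discriminant functions `x ↦ f x y`. -/
def discriminants {𝒳 : Type*} {K : ℕ} (F : Set (𝒳 → EuclideanSpace ℝ (Fin K))) (y : Fin K) :
    Set (𝒳 → ℝ) :=
  {g | ∃ f ∈ F, g = fun x => f x y}

/-- The supremum of the loss over instances, hypotheses in `F` and classes (possibly `∞`). -/
def lossSup {𝒳 : Type*} {K : ℕ} (L : EuclideanSpace ℝ (Fin K) → Fin K → ℝ)
    (F : Set (𝒳 → EuclideanSpace ℝ (Fin K))) : ℝ≥0∞ :=
  ⨆ f ∈ F, ⨆ x : 𝒳, ⨆ y : Fin K, ENNReal.ofReal (L (f x) y)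

/-- The empirical Rademacher complexity of `H` at the points `x`: the expectation of
`sup_{h ∈ H} (1/n) ∑ i, σ i * h (x i)` over independent signs `σ i`, uniform on `{-1, 1}`. The
supremum is taken in the extended reals. -/
def empRademacher {𝒳 : Type*} (H : Set (𝒳 → ℝ)) {n : ℕ} (x : Fin n → 𝒳) : EReal :=
  (((2 : ℝ) ^ n)⁻¹ : ℝ) * ∑ σ : Fin n → ℤˣ,
    ⨆ h ∈ H, (((1 / (n : ℝ)) * ∑ i, (((σ i : ℤˣ) : ℤ) : ℝ) * h (x i) : ℝ) : EReal)

/-- The Rademacher complexity of `H` for `n` i.i.d. points with law `μ`, in `[0, ∞]`. (For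
nonempty `H` the empirical complexity is nonnegative, so `EReal.toENNReal` loses nothing.) -/
def rademacher {𝒳 : Type*} [MeasurableSpace 𝒳] (μ : Measure 𝒳) (n : ℕ) (H : Set (𝒳 → ℝ)) :
    ℝ≥0∞ :=
  ∫⁻ x, (empRademacher H x).toENNReal ∂(Measure.pi (fun _ : Fin n => μ))

/-- Pointwise measurable class: its members are measurable and it has a countable subset of which
each member of the class is a pointwise sequential limit. It makes the suprema over the class that
occur in expectations measurable. For countable discrete `𝒳` every class is of this kind. -/
def PointwiseMeasurable {𝒳 : Type*} [MeasurableSpace 𝒳] {K : ℕ}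
    (F : Set (𝒳 → EuclideanSpace ℝ (Fin K))) : Prop :=
  (∀ f ∈ F, Measurable f) ∧
    ∃ F₀ ⊆ F, F₀.Countable ∧ ∀ f ∈ F, ∃ u : ℕ → 𝒳 → EuclideanSpace ℝ (Fin K),
      (∀ k, u k ∈ F₀) ∧ ∀ x, Tendsto (fun k => u k x) atTop (𝓝 (f x))

/-- The linear-in-parameter model `{x ↦ ⟨w, Φ x⟩ : ‖w‖ ≤ Λ}` with feature map `Φ`. -/
def linearModel {𝒳 H : Type*} [NormedAddCommGroup H] [InnerProductSpace ℝ H] (Φ : 𝒳 → H)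
    (Λ : ℝ) : Set (𝒳 → ℝ) :=
  {g | ∃ w : H, ‖w‖ ≤ Λ ∧ g = fun x => inner ℝ w (Φ x)}

end

end WhichOne

/-! For a class `y` other than the correct one, the label contains `y` with probability p =
(K-I)(K-I-1)/(K(K-1)), and the weight of the outside classes in `qaLoss` is p/(1-p). Wrong classes
therefore cancel in the mean over the question set (`sum_qaLoss_qaLabel`), and the empirical risk is
an unbiased estimate of the classification risk.

Minimality of `fhat` bounds its excess risk by a supremum of risk deviations minus the deviation of
`fstar`. This one random variable is controlled in `exists_uniform_deviation_bound`: the bounded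
differences inequality gives concentration around its mean, and symmetrization bounds the mean by a
Rademacher average of the losses.

Vector contraction (`expect_iSup_le_of_forall_expect_iSup_le`) passes from losses to discriminant
functions: each sign is replaced by K independent signs, one per coordinate. With the elementary
Khintchine constant √K the factor is 2ρ√K, which is below the stated one (`two_mul_sqrt_card_le`).

Suprema are taken over a countable subclass, and pointwise limits carry the bound to all of `F`. For
linear models, orthogonality of independent signs bounds the complexity by rΛ/√n; the losses are
bounded there, so the excess risk bound tends to 0. -/

namespace WhichOne

open scoped BigOperators

/-! ### Vector contraction for Rademacher averages. -/

/-- A sign, as a real number. -/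
abbrev sgn (s : ℤˣ) : ℝ := ((s : ℤ) : ℝ)

@[simp] theorem sgn_one : sgn 1 = 1 := by simp [sgn]

@[simp] theorem sgn_neg (s : ℤˣ) : sgn (-s) = -sgn s := by simp [sgn]

theorem expect_units_int (f : ℤˣ → ℝ) : 𝔼 s, f s = (f 1 + f (-1)) / 2 := by
  rw [Fintype.expect_eq_sum_div_card]
  simp [UnitsInt.univ]

theorem expect_pi_fin_succ {β : Type*} [Fintype β] (n : ℕ) (f : (Fin (n + 1) → β) → ℝ) :
    𝔼 σ, f σ = 𝔼 s : β, 𝔼 σ : Fin n → β, f (Fin.cons s σ) := by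
  rw [← Fintype.expect_equiv (Fin.consEquiv fun _ : Fin (n + 1) => β)
    (fun p => f (Fin.cons p.1 p.2)) f (fun _ => rfl), ← Finset.univ_product_univ,
    Finset.expect_product]

theorem expect_neg_pi {ι : Type*} [Fintype ι] [DecidableEq ι] (f : (ι → ℤˣ) → ℝ) :
    𝔼 τ : ι → ℤˣ, f (-τ) = 𝔼 τ, f τ :=
  Fintype.expect_equiv (Equiv.neg _) _ _ (fun _ => rfl)

/-- The expectation of a function of one coordinate. -/
theorem expect_pi_apply {κ β : Type*} [Fintype κ] [DecidableEq κ] [Fintype β] [Nonempty β]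
    (y : κ) (f : β → ℝ) : 𝔼 τ : κ → β, f (τ y) = 𝔼 b, f b := by
  rw [Fintype.expect_equiv (Equiv.funSplitAt y β) (fun τ => f (τ y)) (fun p => f p.1)
    (fun _ => rfl), ← Finset.univ_product_univ, Finset.expect_product]
  simp

/-- Symmetrization of a sum of two suprema over a finite set, with vector-valued comparison. -/
theorem iSup_add_iSup_le {T κ : Type*} [Finite T] [Nonempty T] [Fintype κ] [DecidableEq κ]
    (a h : T → ℝ) (u : T → κ → ℝ) (c : ℝ)
    (hu : ∀ t t', h t - h t' ≤ c * 𝔼 τ : κ → ℤˣ, |∑ y, sgn (τ y) * (u t y - u t' y)|) :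
    (⨆ t, (a t + h t)) + (⨆ t, (a t - h t)) ≤
      2 * 𝔼 τ : κ → ℤˣ, ⨆ t, (a t + c * ∑ y, sgn (τ y) * u t y) := by
  set S : (κ → ℤˣ) → ℝ := fun τ => ⨆ t, (a t + c * ∑ y, sgn (τ y) * u t y) with hS
  have hle : ∀ τ t, a t + c * ∑ y, sgn (τ y) * u t y ≤ S τ := fun τ t =>
    le_ciSup (f := fun t => a t + c * ∑ y, sgn (τ y) * u t y) (Set.finite_range _).bddAbove t
  have hle' : ∀ τ t, a t - c * ∑ y, sgn (τ y) * u t y ≤ S (-τ) := fun τ t => by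
    refine le_of_eq_of_le ?_ (hle (-τ) t)
    simp [sub_eq_add_neg]
  have key : ∀ t t', (a t + h t) + (a t' - h t') ≤ 2 * 𝔼 τ, S τ := by
    intro t t'
    calc (a t + h t) + (a t' - h t') = (a t + a t') + (h t - h t') := by ring
      _ ≤ (a t + a t') + c * 𝔼 τ : κ → ℤˣ, |∑ y, sgn (τ y) * (u t y - u t' y)| := by
        gcongr; exact hu t t'
      _ = 𝔼 τ : κ → ℤˣ, ((a t + a t') + c * |∑ y, sgn (τ y) * (u t y - u t' y)|) := by
        rw [Finset.expect_add_distrib, Fintype.expect_const, Finset.mul_expect]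
      _ ≤ 𝔼 τ : κ → ℤˣ, (S τ + S (-τ)) := by
        refine Finset.expect_le_expect fun τ _ => ?_
        have e : ∑ y, sgn (τ y) * (u t y - u t' y)
            = ∑ y, sgn (τ y) * u t y - ∑ y, sgn (τ y) * u t' y := by
          rw [← Finset.sum_sub_distrib]
          exact Finset.sum_congr rfl fun _ _ => by ring
        have h1 := hle τ t
        have h2 := hle τ t'
        have h3 := hle' τ t
        have h4 := hle' τ t'
        rw [e]
        -- Whichever sign the difference has, one of `t`, `t'` is charged to `S τ` and the other to
        -- `S (-τ)`.
        rcases abs_cases (∑ y, sgn (τ y) * u t y - ∑ y, sgn (τ y) * u t' y) with h | h <;>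
          rw [h.1] <;> linarith
      _ = 2 * 𝔼 τ, S τ := by
        rw [Finset.expect_add_distrib, expect_neg_pi S]; ring
  have h1 : ∀ t', (⨆ t, (a t + h t)) ≤ 2 * (𝔼 τ, S τ) - (a t' - h t') := fun t' =>
    ciSup_le fun t => by linarith [key t t']
  have h2 : (⨆ t, (a t - h t)) ≤ 2 * (𝔼 τ, S τ) - ⨆ t, (a t + h t) :=
    ciSup_le fun t => by linarith [h1 t]
  linarith

/-- Signs are exchanged one index at a time. The offset `a` is arbitrary so that it can absorb the
other terms: the untreated head when the induction hypothesis is applied to the tail, then the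
treated tail when `iSup_add_iSup_le` treats the head. -/
theorem expect_iSup_add_le {T κ : Type*} [Finite T] [Nonempty T] [Fintype κ] [DecidableEq κ]
    (c : ℝ) (n : ℕ) (a : T → ℝ) (h : Fin n → T → ℝ) (u : Fin n → T → κ → ℝ)
    (hu : ∀ i t t', h i t - h i t' ≤
      c * 𝔼 τ : κ → ℤˣ, |∑ y, sgn (τ y) * (u i t y - u i t' y)|) :
    𝔼 σ : Fin n → ℤˣ, ⨆ t, (a t + ∑ i, sgn (σ i) * h i t) ≤
      𝔼 τ : Fin n → κ → ℤˣ, ⨆ t, (a t + c * ∑ i, ∑ y, sgn (τ i y) * u i t y) := by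
  induction n generalizing a with
  | zero => simp
  | succ n ih =>
    rw [expect_pi_fin_succ, expect_pi_fin_succ]
    calc 𝔼 s : ℤˣ, 𝔼 σ : Fin n → ℤˣ, ⨆ t,
          (a t + ∑ i, sgn ((Fin.cons s σ : Fin (n + 1) → ℤˣ) i) * h i t)
        = 𝔼 s : ℤˣ, 𝔼 σ : Fin n → ℤˣ, ⨆ t,
          ((a t + sgn s * h 0 t) + ∑ i, sgn (σ i) * h i.succ t) := by
          simp [Fin.sum_univ_succ, add_assoc]
      _ ≤ 𝔼 s : ℤˣ, 𝔼 τ : Fin n → κ → ℤˣ, ⨆ t,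
          ((a t + sgn s * h 0 t) + c * ∑ i, ∑ y, sgn (τ i y) * u i.succ t y) :=
          Finset.expect_le_expect fun s _ =>
            ih _ (fun i => h i.succ) (fun i => u i.succ) fun i => hu i.succ
      _ = 𝔼 τ : Fin n → κ → ℤˣ, ((⨆ t,
          ((a t + c * ∑ i, ∑ y, sgn (τ i y) * u i.succ t y) + h 0 t)) + ⨆ t,
          ((a t + c * ∑ i, ∑ y, sgn (τ i y) * u i.succ t y) - h 0 t)) / 2 := by
          rw [Finset.expect_comm]
          refine Finset.expect_congr rfl fun τ _ => ?_
          rw [expect_units_int]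
          congr 3 <;> ext t <;> simp <;> ring
      _ ≤ 𝔼 τ : Fin n → κ → ℤˣ, 𝔼 s : κ → ℤˣ, ⨆ t,
          ((a t + c * ∑ i, ∑ y, sgn (τ i y) * u i.succ t y) + c * ∑ y, sgn (s y) * u 0 t y) := by
          refine Finset.expect_le_expect fun τ _ => ?_
          have := iSup_add_iSup_le (fun t => a t + c * ∑ i, ∑ y, sgn (τ i y) * u i.succ t y)
            (h 0) (u 0) c (hu 0)
          linarith
      _ = _ := by
          rw [Finset.expect_comm]
          refine Finset.expect_congr rfl fun s _ => Finset.expect_congr rfl fun τ _ => ?_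
          congr 1; ext t
          simp [Fin.sum_univ_succ]
          ring

/-- Contraction for Rademacher averages of functions of vectors, over a finite index set. -/
theorem expect_iSup_le_sum_of_finite {T κ : Type*} [Finite T] [Nonempty T] [Fintype κ]
    [DecidableEq κ] (c : ℝ) (hc : 0 ≤ c) (n : ℕ) (h : Fin n → T → ℝ) (u : Fin n → T → κ → ℝ)
    (hu : ∀ i t t', h i t - h i t' ≤
      c * 𝔼 τ : κ → ℤˣ, |∑ y, sgn (τ y) * (u i t y - u i t' y)|) :
    𝔼 σ : Fin n → ℤˣ, ⨆ t, ∑ i, sgn (σ i) * h i t ≤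
      c * ∑ y, 𝔼 σ : Fin n → ℤˣ, ⨆ t, ∑ i, sgn (σ i) * u i t y := by
  have h1 := expect_iSup_add_le c n (fun _ => 0) h u hu
  simp only [zero_add] at h1
  refine h1.trans ?_
  calc 𝔼 τ : Fin n → κ → ℤˣ, ⨆ t, c * ∑ i, ∑ y, sgn (τ i y) * u i t y
      ≤ 𝔼 τ : Fin n → κ → ℤˣ, c * ∑ y, ⨆ t, ∑ i, sgn (τ i y) * u i t y := by
        refine Finset.expect_le_expect fun τ _ => ciSup_le fun t => ?_
        rw [Finset.sum_comm]
        gcongr with y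
        exact le_ciSup (f := fun t => ∑ i, sgn (τ i y) * u i t y) (Set.finite_range _).bddAbove t
    _ = c * ∑ y, 𝔼 τ : Fin n → κ → ℤˣ, ⨆ t, ∑ i, sgn (τ i y) * u i t y := by
        rw [← Finset.mul_expect, Finset.expect_sum_comm]
    _ = _ := by
        congr 1
        refine Finset.sum_congr rfl fun y _ => ?_
        -- For fixed `y` only the signs `τ i y` occur; after transposing the two indices they form
        -- one uniform coordinate.
        rw [← expect_pi_apply y (fun σ : Fin n → ℤˣ => ⨆ t, ∑ i, sgn (σ i) * u i t y)]
        exact Fintype.expect_equiv (Equiv.piComm fun _ _ => ℤˣ) _ _ (fun _ => rfl)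

/-- Flipping all signs except the one at `j` preserves the uniform law. The two signed sums add up
to `2 * sgn (τ j) * v j`, and the triangle inequality concludes. -/
theorem abs_le_expect_abs_sum {κ : Type*} [Fintype κ] [DecidableEq κ] (v : κ → ℝ) (j : κ) :
    |v j| ≤ 𝔼 τ : κ → ℤˣ, |∑ y, sgn (τ y) * v y| := by
  let e : (κ → ℤˣ) ≃ (κ → ℤˣ) :=
    Function.Involutive.toPerm (fun τ => Function.update (-τ) j (τ j)) (fun τ => by
      ext y
      by_cases hy : y = j
      · subst hy; simp
      · simp [hy])
  have he : 𝔼 τ : κ → ℤˣ, |∑ y, sgn (e τ y) * v y| = 𝔼 τ : κ → ℤˣ, |∑ y, sgn (τ y) * v y| :=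
    Fintype.expect_equiv e _ _ (fun _ => rfl)
  have h : ∀ τ : κ → ℤˣ,
      2 * |v j| ≤ |∑ y, sgn (τ y) * v y| + |∑ y, sgn (e τ y) * v y| := by
    intro τ
    have h1 : ∑ y, sgn (τ y) * v y + ∑ y, sgn (e τ y) * v y = 2 * (sgn (τ j) * v j) := by
      rw [← Finset.sum_add_distrib, Finset.sum_eq_single j]
      · simp [e, Function.Involutive.toPerm]; ring
      · intro y _ hy
        simp [e, Function.Involutive.toPerm, hy]
      · simp
    have h2 : |sgn (τ j)| = 1 := by
      rcases Int.units_eq_one_or (τ j) with h | h <;> simp [h]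
    have h3 := abs_add_le (∑ y, sgn (τ y) * v y) (∑ y, sgn (e τ y) * v y)
    rw [h1, abs_mul, abs_mul, h2] at h3
    simpa using h3
  have h4 : 𝔼 _τ : κ → ℤˣ, 2 * |v j| ≤
      𝔼 τ : κ → ℤˣ, (|∑ y, sgn (τ y) * v y| + |∑ y, sgn (e τ y) * v y|) :=
    Finset.expect_le_expect fun τ _ => h τ
  rw [Fintype.expect_const, Finset.expect_add_distrib, he] at h4
  linarith

/-- A Khintchine inequality in finite dimension. -/
theorem norm_le_sqrt_card_mul_expect {K : ℕ} (v : EuclideanSpace ℝ (Fin K)) :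
    ‖v‖ ≤ √K * 𝔼 τ : Fin K → ℤˣ, |∑ y, sgn (τ y) * v y| := by
  set m := 𝔼 τ : Fin K → ℤˣ, |∑ y, sgn (τ y) * v y| with hm
  have hm0 : 0 ≤ m := Finset.expect_nonneg fun _ _ => abs_nonneg _
  rw [EuclideanSpace.norm_eq]
  -- Every coordinate is bounded separately by `m`. This costs √K instead of the sharp constant √2,
  -- which the final constant can afford.
  calc √(∑ i, ‖v i‖ ^ 2) ≤ √(∑ _i : Fin K, m ^ 2) := by
        gcongr with i
        exact abs_le_expect_abs_sum v i
    _ = √K * m := by simp [Real.sqrt_sq hm0]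

/-- Contraction for Rademacher averages of functions of vectors. -/
theorem expect_iSup_le_of_forall_expect_iSup_le {T : Type*} [Nonempty T] {K : ℕ} (c : ℝ)
    (hc : 0 ≤ c) (n : ℕ)
    (h : Fin n → T → ℝ)
    (u : Fin n → T → EuclideanSpace ℝ (Fin K))
    (hu : ∀ i t t', |h i t - h i t'| ≤ c * ‖u i t - u i t'‖) (B : ℝ)
    (hB : ∀ T' : Set T, T'.Finite → T'.Nonempty →
      c * √K * ∑ y, 𝔼 σ : Fin n → ℤˣ, ⨆ t : T', ∑ i, sgn (σ i) * u i t y ≤ B) :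
    𝔼 σ : Fin n → ℤˣ, ⨆ t, ∑ i, sgn (σ i) * h i t ≤ B := by
  refine le_of_forall_pos_le_add fun ε hε => ?_
  -- One near-maximizer per sign vector gives a finite family, to which the finite contraction
  -- applies. An unbounded supremum defaults to 0, and a point above `-ε` then exists all the same.
  have hex : ∀ σ : Fin n → ℤˣ, ∃ t, (⨆ t, ∑ i, sgn (σ i) * h i t) - ε
      < ∑ i, sgn (σ i) * h i t := fun σ =>
    exists_lt_of_lt_ciSup (by linarith)
  choose t ht using hex
  have : Finite (Set.range t) := (Set.finite_range t)
  calc 𝔼 σ : Fin n → ℤˣ, ⨆ t, ∑ i, sgn (σ i) * h i t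
      ≤ 𝔼 σ : Fin n → ℤˣ, ((⨆ t' : Set.range t, ∑ i, sgn (σ i) * h i t') + ε) := by
        refine Finset.expect_le_expect fun σ _ => ?_
        have := le_ciSup (f := fun t' : Set.range t => ∑ i, sgn (σ i) * h i t')
          (Set.finite_range _).bddAbove ⟨t σ, σ, rfl⟩
        have := ht σ
        simp only at *
        linarith
    _ = (𝔼 σ : Fin n → ℤˣ, ⨆ t' : Set.range t, ∑ i, sgn (σ i) * h i t') + ε := by
        rw [Finset.expect_add_distrib, Fintype.expect_const]
    _ ≤ B + ε := by
        gcongr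
        refine le_trans ?_ (hB (Set.range t) (Set.finite_range t) (Set.range_nonempty t))
        refine expect_iSup_le_sum_of_finite (T := Set.range t) (κ := Fin K) (c * √K)
          (by positivity) n (fun i t => h i t) (fun i t y => u i t y) fun i s s' => ?_
        refine (le_abs_self _).trans ((hu i s s').trans ?_)
        rw [mul_assoc]
        gcongr
        exact norm_le_sqrt_card_mul_expect (u i s - u i s')

/-! ### The bounded differences inequality. -/

theorem integrable_of_abs_le {Ω : Type*} [MeasurableSpace Ω] {ν : Measure Ω} [IsFiniteMeasure ν]
    {f : Ω → ℝ} (hf : Measurable f) {B : ℝ} (hB : ∀ ω, |f ω| ≤ B) : Integrable f ν :=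
  Integrable.of_bound hf.aestronglyMeasurable B (Eventually.of_forall hB)

theorem abs_exp_mul_sub_le (t m : ℝ) {x B : ℝ} (hx : |x| ≤ B) :
    |Real.exp (t * (x - m))| ≤ Real.exp (|t| * (B + |m|)) := by
  rw [Real.abs_exp]
  refine Real.exp_le_exp.2 ((le_abs_self _).trans ?_)
  rw [abs_mul]
  gcongr
  exact (abs_sub _ _).trans (by gcongr)

theorem piFinSuccAbove_zero_symm_eq {Ω : Type*} [MeasurableSpace Ω] (n : ℕ) :
    (fun p : Ω × (Fin n → Ω) => (Fin.cons p.1 p.2 : Fin (n + 1) → Ω)) =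
      (MeasurableEquiv.piFinSuccAbove (fun _ : Fin (n + 1) => Ω) 0).symm := by
  funext p
  exact (Fin.insertNth_zero' p.1 p.2).symm

theorem measurePreserving_finCons {Ω : Type*} [MeasurableSpace Ω] (ν : Measure Ω)
    [IsProbabilityMeasure ν] (n : ℕ) :
    MeasurePreserving (fun p : Ω × (Fin n → Ω) => (Fin.cons p.1 p.2 : Fin (n + 1) → Ω))
      (ν.prod (Measure.pi fun _ => ν)) (Measure.pi fun _ => ν) := by
  rw [piFinSuccAbove_zero_symm_eq]
  exact (measurePreserving_piFinSuccAbove (fun _ : Fin (n + 1) => ν) 0).symm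

theorem measurableEmbedding_finCons {Ω : Type*} [MeasurableSpace Ω] (n : ℕ) :
    MeasurableEmbedding (fun p : Ω × (Fin n → Ω) => (Fin.cons p.1 p.2 : Fin (n + 1) → Ω)) := by
  rw [piFinSuccAbove_zero_symm_eq]
  exact MeasurableEquiv.measurableEmbedding _

theorem integral_pi_fin_succ {Ω : Type*} [MeasurableSpace Ω] (ν : Measure Ω)
    [IsProbabilityMeasure ν] {n : ℕ} {f : (Fin (n + 1) → Ω) → ℝ}
    (hf : Integrable f (Measure.pi fun _ => ν)) :
    ∫ S, f S ∂(Measure.pi fun _ => ν) =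
      ∫ z, ∫ S, f (Fin.cons z S) ∂(Measure.pi fun _ : Fin n => ν) ∂ν := by
  have h := measurePreserving_finCons ν n
  rw [← h.integral_comp (measurableEmbedding_finCons n) f, integral_prod]
  exact (h.integrable_comp_emb (measurableEmbedding_finCons n)).2 hf

/-- **Bounded differences inequality**, bound on the moment generating function. -/
theorem integral_exp_sub_le_of_bounded_differences {Ω : Type*} [MeasurableSpace Ω] (ν : Measure Ω)
    [IsProbabilityMeasure ν] {c : ℝ} (t : ℝ) (n : ℕ) (G : (Fin n → Ω) → ℝ) (hG : Measurable G)
    {B : ℝ} (hB : ∀ S, |G S| ≤ B)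
    (hd : ∀ S i z, |G (Function.update S i z) - G S| ≤ c) :
    ∫ S, Real.exp (t * (G S - ∫ S, G S ∂(Measure.pi fun _ => ν))) ∂(Measure.pi fun _ => ν) ≤
      Real.exp (n * ((c / 2) ^ 2 * t ^ 2 / 2)) := by
  induction n with
  | zero =>
    have h : ∀ S, G S = G default := fun S => congrArg G (Subsingleton.elim _ _)
    simp [h]
  | succ n ih =>
    obtain ⟨z₀⟩ : Nonempty Ω := nonempty_of_isProbabilityMeasure ν
    set m := ∫ S, G S ∂(Measure.pi fun _ : Fin (n + 1) => ν) with hm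
    have hcons : Measurable fun p : Ω × (Fin n → Ω) => (Fin.cons p.1 p.2 : Fin (n + 1) → Ω) :=
      (measurableEmbedding_finCons n).measurable
    have hGc : Measurable fun p : Ω × (Fin n → Ω) => G (Fin.cons p.1 p.2) := hG.comp hcons
    have hGz : ∀ z, Measurable fun S : Fin n → Ω => G (Fin.cons z S) := fun z =>
      hGc.comp measurable_prodMk_left
    have hGi : ∀ z, Integrable (fun S : Fin n → Ω => G (Fin.cons z S)) (Measure.pi fun _ => ν) :=
      fun z => integrable_of_abs_le (hGz z) fun S => hB _
    -- `g` is the conditional expectation of `G` given the first coordinate. In G - m = (g - m) + (G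
    -- - g), the first part has oscillation at most `c`, so Hoeffding's lemma applies; the second is
    -- covered by the induction hypothesis for each fixed first coordinate.
    set g : Ω → ℝ := fun z => ∫ S, G (Fin.cons z S) ∂(Measure.pi fun _ : Fin n => ν) with hg
    have hgm : Measurable g := (hGc.stronglyMeasurable.integral_prod_right').measurable
    have hmg : m = ∫ z, g z ∂ν := integral_pi_fin_succ ν (integrable_of_abs_le hG hB)
    have hgd : ∀ z z', g z - g z' ≤ c := by
      intro z z'
      rw [hg]
      simp only
      rw [← integral_sub (hGi z) (hGi z')]
      calc ∫ S, (G (Fin.cons z S) - G (Fin.cons z' S)) ∂(Measure.pi fun _ : Fin n => ν)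
          ≤ ∫ _, c ∂(Measure.pi fun _ : Fin n => ν) := by
            refine integral_mono ((hGi z).sub (hGi z')) (integrable_const _) fun S => ?_
            have := hd (Fin.cons z' S) 0 z
            rw [Fin.update_cons_zero] at this
            exact (le_abs_self _).trans this
        _ = c := by simp
    have hc : 0 ≤ c := by simpa using hgd z₀ z₀
    have hgbdd : BddBelow (Set.range g) :=
      ⟨g z₀ - c, by rintro _ ⟨z, rfl⟩; linarith [hgd z₀ z]⟩
    have hsub : HasSubgaussianMGF (fun z => g z - ∫ z, g z ∂ν)
        ((‖((⨅ z, g z) + c) - ⨅ z, g z‖₊ / 2) ^ 2) ν := by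
      have : Nonempty Ω := ⟨z₀⟩
      refine hasSubgaussianMGF_of_mem_Icc hgm.aemeasurable (Eventually.of_forall fun z => ?_)
      -- The interval runs from the infimum of `g` to that infimum plus `c`.
      refine ⟨ciInf_le hgbdd z, ?_⟩
      rw [← sub_le_iff_le_add]
      exact le_ciInf fun z' => by linarith [hgd z z']
    have hgB : ∀ z, |g z| ≤ B := fun z => by
      have := norm_integral_le_of_norm_le_const (μ := Measure.pi fun _ : Fin n => ν)
        (f := fun S => G (Fin.cons z S)) (C := B) (Eventually.of_forall fun S => hB _)
      simpa using this
    have hint : Integrable (fun S => Real.exp (t * (G S - m)))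
        (Measure.pi fun _ : Fin (n + 1) => ν) :=
      integrable_of_abs_le (by fun_prop) fun S => abs_exp_mul_sub_le t m (hB S)
    have hint' : Integrable (fun z => Real.exp (t * (g z - m))) ν :=
      integrable_of_abs_le (by fun_prop) fun z => abs_exp_mul_sub_le t m (hgB z)
    set E := Real.exp (n * ((c / 2) ^ 2 * t ^ 2 / 2)) with hE
    calc ∫ S, Real.exp (t * (G S - m)) ∂(Measure.pi fun _ => ν)
        = ∫ z, ∫ S, Real.exp (t * (G (Fin.cons z S) - m)) ∂(Measure.pi fun _ : Fin n => ν) ∂ν :=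
          integral_pi_fin_succ ν hint
      _ = ∫ z, Real.exp (t * (g z - m)) * ∫ S, Real.exp (t * (G (Fin.cons z S) - g z))
            ∂(Measure.pi fun _ : Fin n => ν) ∂ν := by
          refine integral_congr_ae (Eventually.of_forall fun z => ?_)
          simp only
          rw [← integral_const_mul]
          refine integral_congr_ae (Eventually.of_forall fun S => ?_)
          simp only
          rw [← Real.exp_add]
          ring_nf
      _ ≤ ∫ z, Real.exp (t * (g z - m)) * E ∂ν := by
          refine integral_mono_of_nonneg (Eventually.of_forall fun z => ?_)
            (hint'.mul_const _) (Eventually.of_forall fun z => ?_)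
          · exact mul_nonneg (Real.exp_nonneg _) (integral_nonneg fun _ => Real.exp_nonneg _)
          · refine mul_le_mul_of_nonneg_left ?_ (Real.exp_nonneg _)
            refine ih (fun S => G (Fin.cons z S)) (hGz z) (fun S => hB _) fun S i w => ?_
            have := hd (Fin.cons z S) i.succ w
            rwa [← Fin.cons_update] at this
      _ = (∫ z, Real.exp (t * (g z - m)) ∂ν) * E := integral_mul_const _ _
      _ ≤ Real.exp ((c / 2) ^ 2 * t ^ 2 / 2) * E := by
          gcongr
          have := hsub.mgf_le t
          rw [mgf, ← hmg] at this
          refine this.trans_eq ?_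
          congr 1
          simp [div_pow, abs_of_nonneg hc]
      _ = _ := by
          rw [hE, ← Real.exp_add]
          congr 1
          push_cast
          ring

/-- **Bounded differences inequality** of McDiarmid. -/
theorem measureReal_ge_le_of_bounded_differences {Ω : Type*} [MeasurableSpace Ω] (ν : Measure Ω)
    [IsProbabilityMeasure ν] {c : ℝ} (n : ℕ) (G : (Fin n → Ω) → ℝ) (hG : Measurable G)
    {B : ℝ} (hB : ∀ S, |G S| ≤ B) (hd : ∀ S i z, |G (Function.update S i z) - G S| ≤ c)
    {ε : ℝ} (hε : 0 ≤ ε) :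
    (Measure.pi fun _ => ν).real {S | ε ≤ G S - ∫ S, G S ∂(Measure.pi fun _ => ν)} ≤
      Real.exp (-ε ^ 2 / (2 * (n * (c / 2) ^ 2))) := by
  set m := ∫ S, G S ∂(Measure.pi fun _ => ν) with hm
  have h : HasSubgaussianMGF (fun S => G S - m) (n * (‖c‖₊ / 2) ^ 2) (Measure.pi fun _ => ν) := by
    refine ⟨fun t => ?_, fun t => ?_⟩
    · refine integrable_of_abs_le (B := Real.exp (|t| * (B + |m|))) (by fun_prop) fun S =>
        abs_exp_mul_sub_le t m (hB S)
    · refine (integral_exp_sub_le_of_bounded_differences ν t n G hG hB hd).trans_eq ?_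
      congr 1
      simp [div_pow]
      ring
  refine (h.measure_ge_le hε).trans_eq ?_
  simp [div_pow]

/-! ### Symmetrization and uniform deviations. -/

theorem bddAbove_range_of_abs_le {ι : Type*} {f : ι → ℝ} {B : ℝ} (h : ∀ i, |f i| ≤ B) :
    BddAbove (Set.range f) :=
  ⟨B, by rintro _ ⟨i, rfl⟩; exact (abs_le.1 (h i)).2⟩

theorem abs_ciSup_le {ι : Type*} [Nonempty ι] {f : ι → ℝ} {B : ℝ} (h : ∀ i, |f i| ≤ B) :
    |⨆ i, f i| ≤ B := by
  obtain ⟨i⟩ := ‹Nonempty ι›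
  exact abs_le.2 ⟨(abs_le.1 (h i)).1.trans (le_ciSup (bddAbove_range_of_abs_le h) i),
    ciSup_le fun i => (abs_le.1 (h i)).2⟩

theorem abs_sgn (s : ℤˣ) : |sgn s| = 1 := by
  rcases Int.units_eq_one_or s with h | h <;> simp [h]

theorem abs_sum_fin_le {n : ℕ} {f : Fin n → ℝ} {B : ℝ} (h : ∀ j, |f j| ≤ B) :
    |∑ j, f j| ≤ n * B := by
  refine (Finset.abs_sum_le_sum_abs _ _).trans ((Finset.sum_le_sum fun j _ => h j).trans ?_)
  simp

theorem abs_integral_le {Ω : Type*} [MeasurableSpace Ω] {ν : Measure Ω} [IsProbabilityMeasure ν]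
    {f : Ω → ℝ} {B : ℝ} (hB : ∀ ω, |f ω| ≤ B) : |∫ ω, f ω ∂ν| ≤ B := by
  simpa using norm_integral_le_of_norm_le_const (μ := ν) (f := f) (C := B)
    (Eventually.of_forall hB)

/-- **Symmetrization** for a uniformly bounded countable class. -/
theorem integral_iSup_le_two_mul_rademacher {Ω ι : Type*} [MeasurableSpace Ω] (ν : Measure Ω)
    [IsProbabilityMeasure ν] [Countable ι] [Nonempty ι] (n : ℕ) (l : ι → Ω → ℝ)
    (hl : ∀ i, Measurable (l i)) {B : ℝ} (hB : ∀ i ω, |l i ω| ≤ B) :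
    ∫ S, ⨆ i, ∑ j, ((∫ ω, l i ω ∂ν) - l i (S j)) ∂(Measure.pi fun _ : Fin n => ν) ≤
      2 * ∫ S, 𝔼 σ : Fin n → ℤˣ, ⨆ i, ∑ j, sgn (σ j) * l i (S j)
        ∂(Measure.pi fun _ : Fin n => ν) := by
  have hd : ∀ i ω ω', |l i ω - l i ω'| ≤ B + B := fun i ω ω' =>
    (abs_sub _ _).trans (add_le_add (hB i ω) (hB i ω'))
  have hs : ∀ (σ : Fin n → ℤˣ) i (S : Fin n → Ω), |∑ j, sgn (σ j) * l i (S j)| ≤ n * B := fun σ i S =>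
    abs_sum_fin_le fun j => by rw [abs_mul, abs_sgn, one_mul]; exact hB _ _
  set μ : Measure (Fin n → Ω) := Measure.pi fun _ : Fin n => ν with hμ
  set φ : (Fin n → ℤˣ) → ℝ := fun σ => ∫ S, ⨆ i, ∑ j, sgn (σ j) * l i (S j) ∂μ with hφ
  have hφm : ∀ σ : Fin n → ℤˣ, Measurable fun S : Fin n → Ω => ⨆ i, ∑ j, sgn (σ j) * l i (S j) :=
    fun σ => Measurable.iSup fun i => Finset.measurable_fun_sum _ fun j _ =>
      ((hl i).comp (measurable_pi_apply j)).const_mul _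
  have hφi : ∀ σ : Fin n → ℤˣ, Integrable (fun S => ⨆ i, ∑ j, sgn (σ j) * l i (S j)) μ :=
    fun σ => integrable_of_abs_le (hφm σ) fun S => abs_ciSup_le fun i => hs σ i S
  -- Each sample point is paired with an independent ghost copy.
  set ψ : (Fin n → Ω × Ω) → ℝ := fun w => ⨆ i, ∑ j, (l i (w j).2 - l i (w j).1) with hψ
  have hψm : Measurable ψ := Measurable.iSup fun i => Finset.measurable_fun_sum _ fun j _ =>
    ((hl i).comp (measurable_snd.comp (measurable_pi_apply j))).sub
      ((hl i).comp (measurable_fst.comp (measurable_pi_apply j)))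
  have hψb : ∀ w, |ψ w| ≤ n * (B + B) := fun w => abs_ciSup_le fun i => abs_sum_fin_le fun j =>
    hd _ _ _
  set μ2 : Measure (Fin n → Ω × Ω) := Measure.pi fun _ : Fin n => ν.prod ν with hμ2
  have hpair := measurePreserving_arrowProdEquivProdArrow Ω Ω (Fin n) (fun _ => ν) (fun _ => ν)
  set e := MeasurableEquiv.arrowProdEquivProdArrow Ω Ω (Fin n) with he
  have hψe : ∀ S S', ψ (e.symm (S, S')) = ⨆ i, ∑ j, (l i (S' j) - l i (S j)) := fun S S' => rfl
  have hψei : Integrable (fun p => ψ (e.symm p)) (μ.prod μ) :=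
    integrable_of_abs_le (hψm.comp e.symm.measurable) fun p => hψb _
  -- Each mean is the expectation over the ghost sample, and a supremum of expectations is at most
  -- the expectation of the supremum.
  have step1 : ∫ S, ⨆ i, ∑ j, ((∫ ω, l i ω ∂ν) - l i (S j)) ∂μ ≤ ∫ w, ψ w ∂μ2 := by
    have h1 : ∫ w, ψ w ∂μ2 = ∫ S, ∫ S', ψ (e.symm (S, S')) ∂μ ∂μ := by
      rw [← integral_prod _ hψei]
      exact (hpair.symm.integral_comp e.symm.measurableEmbedding ψ).symm
    rw [h1]
    refine integral_mono (integrable_of_abs_le (B := n * (B + B)) ?_ fun S => ?_)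
      hψei.integral_prod_left fun S => ciSup_le fun i => ?_
    · exact Measurable.iSup fun i => Finset.measurable_fun_sum _ fun j _ =>
        measurable_const.sub ((hl i).comp (measurable_pi_apply j))
    · exact abs_ciSup_le fun i => abs_sum_fin_le fun j =>
        (abs_sub _ _).trans (add_le_add (abs_integral_le (hB i)) (hB i _))
    · have hlj : ∀ j, Integrable (fun S' : Fin n → Ω => l i (S' j) - l i (S j)) μ := fun j =>
        integrable_of_abs_le (((hl i).comp (measurable_pi_apply j)).sub_const _) fun S' => hd _ _ _
      calc ∑ j, ((∫ ω, l i ω ∂ν) - l i (S j))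
          = ∫ S', ∑ j, (l i (S' j) - l i (S j)) ∂μ := by
            rw [integral_finsetSum _ fun j _ => hlj j]
            refine Finset.sum_congr rfl fun j _ => ?_
            have hint : Integrable (fun S' : Fin n → Ω => l i (S' j)) μ :=
              integrable_of_abs_le ((hl i).comp (measurable_pi_apply j)) fun S' => hB i _
            rw [integral_sub hint (integrable_const _),
              integral_comp_eval (μ := fun _ : Fin n => ν) (hl i).aestronglyMeasurable]
            simp
        _ ≤ ∫ S', ψ (e.symm (S, S')) ∂μ := by
            refine integral_mono (integrable_finsetSum _ fun j _ => hlj j)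
              (integrable_of_abs_le (hψm.comp (e.symm.measurable.comp measurable_prodMk_left))
                fun S' => hψb _) fun S' => ?_
            simp only [hψe]
            exact le_ciSup (f := fun i => ∑ j, (l i (S' j) - l i (S j)))
              (bddAbove_range_of_abs_le fun i => abs_sum_fin_le fun j => hd _ _ _) i
  have step2 : ∀ σ : Fin n → ℤˣ, ∫ w, ψ w ∂μ2 ≤ φ σ + φ (-σ) := by
    intro σ
    -- Swapping the pairs whose sign is -1 preserves the law and multiplies the differences by the
    -- signs. The supremum then splits into two, one for `σ` and one for `-σ`, which agree after
    -- averaging over `σ`.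
    let sw : ℤˣ → Ω × Ω → Ω × Ω := fun s => if s = 1 then id else Prod.swap
    have hsw : MeasurePreserving (fun w (j : Fin n) => sw (σ j) (w j)) μ2 μ2 := by
      refine measurePreserving_pi _ _ fun j => ?_
      by_cases h : σ j = 1
      · simpa [sw, h] using MeasurePreserving.id (ν.prod ν)
      · simpa [sw, h] using Measure.measurePreserving_swap (μ := ν) (ν := ν)
    have hfst : MeasurePreserving (fun (w : Fin n → Ω × Ω) j => (w j).1) μ2 μ :=
      measurePreserving_pi _ _ fun j => measurePreserving_fst
    have hsnd : MeasurePreserving (fun (w : Fin n → Ω × Ω) j => (w j).2) μ2 μ :=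
      measurePreserving_pi _ _ fun j => measurePreserving_snd
    have hψsw : ∀ w : Fin n → Ω × Ω, ψ (fun j => sw (σ j) (w j)) =
        ⨆ i, ∑ j, sgn (σ j) * (l i (w j).2 - l i (w j).1) := by
      intro w
      refine iSup_congr fun i => Finset.sum_congr rfl fun j _ => ?_
      rcases Int.units_eq_one_or (σ j) with h | h <;> simp [sw, h]
    have hi2 := hsnd.integrable_comp_of_integrable (hφi σ)
    have hi1 := hfst.integrable_comp_of_integrable (hφi (-σ))
    calc ∫ w, ψ w ∂μ2 = ∫ w, ψ (fun j => sw (σ j) (w j)) ∂μ2 := by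
          conv_lhs => rw [← hsw.map_eq]
          exact integral_map hsw.measurable.aemeasurable hψm.aestronglyMeasurable
      _ ≤ ∫ w, ((⨆ i, ∑ j, sgn (σ j) * l i (w j).2) +
            ⨆ i, ∑ j, sgn ((-σ) j) * l i (w j).1) ∂μ2 := by
          refine integral_mono (integrable_of_abs_le (hψm.comp hsw.measurable) fun w => hψb _)
            (hi2.add hi1) fun w => ?_
          simp only [hψsw]
          refine ciSup_le fun i => ?_
          have e1 : ∑ j, sgn (σ j) * (l i (w j).2 - l i (w j).1) =
              ∑ j, sgn (σ j) * l i (w j).2 + ∑ j, sgn ((-σ) j) * l i (w j).1 := by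
            rw [← Finset.sum_add_distrib]
            refine Finset.sum_congr rfl fun j _ => ?_
            rw [Pi.neg_apply, sgn_neg]
            ring
          rw [e1]
          exact add_le_add
            (le_ciSup (f := fun i => ∑ j, sgn (σ j) * l i (w j).2)
              (bddAbove_range_of_abs_le fun i => hs σ i fun j => (w j).2) i)
            (le_ciSup (f := fun i => ∑ j, sgn ((-σ) j) * l i (w j).1)
              (bddAbove_range_of_abs_le fun i => hs (-σ) i fun j => (w j).1) i)
      _ = φ σ + φ (-σ) := by
          refine (integral_add hi2 hi1).trans ?_
          rw [hφ]
          congr 1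
          · rw [← hsnd.map_eq]
            exact (integral_map hsnd.measurable.aemeasurable (hφm σ).aestronglyMeasurable).symm
          · rw [← hfst.map_eq]
            exact (integral_map hfst.measurable.aemeasurable (hφm (-σ)).aestronglyMeasurable).symm
  have step3 : ∫ S, 𝔼 σ : Fin n → ℤˣ, ⨆ i, ∑ j, sgn (σ j) * l i (S j) ∂μ = 𝔼 σ, φ σ := by
    simp_rw [Fintype.expect_eq_sum_div_card]
    rw [integral_div, integral_finsetSum _ fun σ _ => hφi σ]
  rw [step3]
  refine step1.trans ?_
  calc ∫ w, ψ w ∂μ2 = 𝔼 _σ : Fin n → ℤˣ, ∫ w, ψ w ∂μ2 := (Fintype.expect_const _).symm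
    _ ≤ 𝔼 σ : Fin n → ℤˣ, (φ σ + φ (-σ)) := Finset.expect_le_expect fun σ _ => step2 σ
    _ = 2 * 𝔼 σ, φ σ := by rw [Finset.expect_add_distrib, expect_neg_pi φ]; ring

theorem abs_iSup_sub_iSup_le {ι : Type*} [Nonempty ι] {f g : ι → ℝ} {B M : ℝ}
    (hf : ∀ i, |f i| ≤ B) (hg : ∀ i, |g i| ≤ B) (h : ∀ i, |f i - g i| ≤ M) :
    |(⨆ i, f i) - ⨆ i, g i| ≤ M := by
  have h1 : (⨆ i, f i) ≤ (⨆ i, g i) + M := ciSup_le fun i => by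
    linarith [(abs_le.1 (h i)).2, le_ciSup (bddAbove_range_of_abs_le hg) i]
  have h2 : (⨆ i, g i) ≤ (⨆ i, f i) + M := ciSup_le fun i => by
    linarith [(abs_le.1 (h i)).1, le_ciSup (bddAbove_range_of_abs_le hf) i]
  exact abs_le.2 ⟨by linarith, by linarith⟩

theorem sum_update_sub_sum {Ω : Type*} {n : ℕ} (f : Ω → ℝ) (S : Fin n → Ω) (j : Fin n) (z : Ω) :
    ∑ i, f (Function.update S j z i) - ∑ i, f (S i) = f z - f (S j) := by
  rw [← Finset.sum_sub_distrib, Finset.sum_eq_single j]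
  · simp
  · intro i _ hi; simp [hi]
  · simp

/-- High-probability bound on the uniform deviation between excess risk and empirical excess risk,
for a countable class of losses with values in an interval of length `M`. -/
theorem exists_uniform_deviation_bound {Ω ι : Type*} [MeasurableSpace Ω] (ν : Measure Ω)
    [IsProbabilityMeasure ν] [Countable ι] {n : ℕ} (hn : 1 ≤ n) (l : ι → Ω → ℝ)
    (hl : ∀ i, Measurable (l i)) {a M : ℝ} (hM : 0 < M) (hlM : ∀ i ω, l i ω ∈ Set.Icc a (a + M))
    (i₀ : ι) {δ : ℝ} (hδ : 0 < δ) (hδ1 : δ < 1) :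
    ∃ A : Set (Fin n → Ω), MeasurableSet A ∧
      ENNReal.ofReal (1 - δ) ≤ (Measure.pi fun _ : Fin n => ν) A ∧
      ∀ S ∈ A, ∀ i,
        ((∫ ω, l i ω ∂ν) - 1 / (n : ℝ) * ∑ j, l i (S j))
          + (1 / (n : ℝ) * ∑ j, l i₀ (S j) - ∫ ω, l i₀ ω ∂ν) ≤
        2 * ∫ S, 𝔼 σ : Fin n → ℤˣ, ⨆ i, 1 / (n : ℝ) * ∑ j, sgn (σ j) * l i (S j)
          ∂(Measure.pi fun _ : Fin n => ν) + M * √(2 * Real.log (2 / δ) / n) := by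
  have : Nonempty ι := ⟨i₀⟩
  have hn0 : (0 : ℝ) < n := by exact_mod_cast hn
  -- `B` serves only for integrability and bounded suprema; the range length `M` alone enters the
  -- concentration term.
  set B := |a| + M with hBdef
  have hB : ∀ i ω, |l i ω| ≤ B := fun i ω => by
    have := hlM i ω
    exact abs_le.2 ⟨by linarith [neg_abs_le a, this.1], by linarith [le_abs_self a, this.2]⟩
  have hdM : ∀ i ω ω', |l i ω - l i ω'| ≤ M := fun i ω ω' => by
    have h1 := hlM i ω
    have h2 := hlM i ω'
    exact abs_le.2 ⟨by linarith [h1.1, h2.2], by linarith [h1.2, h2.1]⟩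
  set μ : Measure (Fin n → Ω) := Measure.pi fun _ : Fin n => ν with hμ
  set R : ι → ℝ := fun i => ∫ ω, l i ω ∂ν with hR
  set U : (Fin n → Ω) → ℝ := fun S => ⨆ i, ∑ j, (R i - l i (S j)) with hU
  have hd : ∀ i ω, |R i - l i ω| ≤ B + B := fun i ω =>
    (abs_sub _ _).trans (add_le_add (abs_integral_le (hB i)) (hB i _))
  have hUi : ∀ i (S : Fin n → Ω), |∑ j, (R i - l i (S j))| ≤ n * (B + B) := fun i S =>
    abs_sum_fin_le fun j => hd _ _
  have hUm : Measurable U := Measurable.iSup fun i => Finset.measurable_fun_sum _ fun j _ =>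
    measurable_const.sub ((hl i).comp (measurable_pi_apply j))
  have hUb : ∀ S, |U S| ≤ n * (B + B) := fun S => abs_ciSup_le fun i => hUi i S
  set V : (Fin n → Ω) → ℝ := fun S => ∑ j, (R i₀ - l i₀ (S j)) with hV
  have hVm : Measurable V := Finset.measurable_fun_sum _ fun j _ =>
    measurable_const.sub ((hl i₀).comp (measurable_pi_apply j))
  have hVint : ∫ S, V S ∂μ = 0 := by
    have hlj : ∀ j, Integrable (fun S : Fin n → Ω => R i₀ - l i₀ (S j)) μ := fun j =>
      integrable_of_abs_le (measurable_const.sub ((hl i₀).comp (measurable_pi_apply j)))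
        fun S => hd _ _
    rw [hV, integral_finsetSum _ fun j _ => hlj j]
    refine Finset.sum_eq_zero fun j _ => ?_
    have hint : Integrable (fun S : Fin n → Ω => l i₀ (S j)) μ :=
      integrable_of_abs_le ((hl i₀).comp (measurable_pi_apply j)) fun S => hB i₀ _
    rw [integral_sub (integrable_const _) hint,
      integral_comp_eval (μ := fun _ : Fin n => ν) (hl i₀).aestronglyMeasurable]
    simp [R]
  -- Taking the deviation of `i₀` together with the supremum needs only one tail bound. `V` has mean
  -- zero, so `G` has the mean of `U`; changing one point alters each of `U` and `V` by at most `M`.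
  set G : (Fin n → Ω) → ℝ := fun S => U S - V S with hG
  have hGm : Measurable G := hUm.sub hVm
  have hGb : ∀ S, |G S| ≤ n * (B + B) + n * (B + B) := fun S =>
    (abs_sub _ _).trans (add_le_add (hUb S) (hUi i₀ S))
  have hsumd : ∀ i (S : Fin n → Ω) j z,
      |∑ k, (R i - l i (Function.update S j z k)) - ∑ k, (R i - l i (S k))| ≤ M := by
    intro i S j z
    rw [sum_update_sub_sum (fun ω => R i - l i ω)]
    rw [sub_sub_sub_cancel_left]
    exact hdM _ _ _
  have hGd : ∀ S j z, |G (Function.update S j z) - G S| ≤ 2 * M := by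
    intro S j z
    have h1 : |U (Function.update S j z) - U S| ≤ M :=
      abs_iSup_sub_iSup_le (fun i => hUi i _) (fun i => hUi i _) fun i => hsumd i S j z
    have h2 : |V (Function.update S j z) - V S| ≤ M := hsumd i₀ S j z
    calc |G (Function.update S j z) - G S|
        = |(U (Function.update S j z) - U S) - (V (Function.update S j z) - V S)| := by
          rw [hG]; ring_nf
      _ ≤ 2 * M := (abs_sub _ _).trans (by linarith)
  set m := ∫ S, G S ∂μ with hm
  have hmU : m = ∫ S, U S ∂μ := by
    rw [hm, hG, integral_sub (integrable_of_abs_le hUm hUb)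
      (integrable_of_abs_le hVm fun S => hUi i₀ S), hVint, sub_zero]
  have hlog : 0 < Real.log (2 / δ) := Real.log_pos (by rw [lt_div_iff₀ hδ]; linarith)
  set ε := M * √(2 * n * Real.log (2 / δ)) with hε
  have hε0 : 0 ≤ ε := by positivity
  have htail := measureReal_ge_le_of_bounded_differences ν n G hGm hGb hGd hε0
  -- With differences 2M the exponent is -ε²/(2nM²), and `ε` is chosen to make it -log(2/δ). The
  -- discarded probability is thus at most δ/2.
  have hexp : Real.exp (-ε ^ 2 / (2 * (n * (2 * M / 2) ^ 2))) = δ / 2 := by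
    have : -ε ^ 2 / (2 * (n * (2 * M / 2) ^ 2)) = -Real.log (2 / δ) := by
      rw [hε, mul_pow, Real.sq_sqrt (by positivity)]
      field_simp
    rw [this, ← Real.log_inv, Real.exp_log (by positivity)]
    simp
  rw [hexp] at htail
  have hmeas : MeasurableSet {S | ε ≤ G S - m} := measurableSet_le measurable_const
    (hGm.sub_const _)
  refine ⟨{S | ε ≤ G S - m}ᶜ, hmeas.compl, ?_, fun S hS i => ?_⟩
  · rw [← ofReal_measureReal, probReal_compl_eq_one_sub hmeas]
    refine ENNReal.ofReal_le_ofReal ?_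
    have : μ.real {S | ε ≤ G S - m} ≤ δ / 2 := htail
    linarith
  · simp only [Set.mem_compl_iff, Set.mem_ofPred_eq, not_le] at hS
    have h1 : ∑ j, (R i - l i (S j)) ≤ U S :=
      le_ciSup (bddAbove_range_of_abs_le fun i => hUi i S) i
    have h2 := integral_iSup_le_two_mul_rademacher ν n l hl hB
    have h3 : ∫ S, 𝔼 σ : Fin n → ℤˣ, ⨆ i, 1 / (n : ℝ) * ∑ j, sgn (σ j) * l i (S j) ∂μ =
        1 / n * ∫ S, 𝔼 σ : Fin n → ℤˣ, ⨆ i, ∑ j, sgn (σ j) * l i (S j) ∂μ := by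
      rw [← integral_const_mul]
      refine integral_congr_ae (Eventually.of_forall fun S => ?_)
      simp only
      rw [Finset.mul_expect]
      refine Finset.expect_congr rfl fun σ _ => ?_
      rw [Real.mul_iSup_of_nonneg (by positivity)]
    have h4 : ε = n * (M * √(2 * Real.log (2 / δ) / n)) := by
      have : 2 * n * Real.log (2 / δ) = n ^ 2 * (2 * Real.log (2 / δ) / n) := by
        field_simp
      rw [hε, this, Real.sqrt_mul (by positivity), Real.sqrt_sq hn0.le]
      ring
    have h5 : n * ((R i - 1 / n * ∑ j, l i (S j)) + (1 / n * ∑ j, l i₀ (S j) - R i₀)) =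
        ∑ j, (R i - l i (S j)) - V S := by
      rw [hV]
      simp only [Finset.sum_sub_distrib, Finset.sum_const, Finset.card_univ, Fintype.card_fin,
        nsmul_eq_mul]
      field_simp
      ring
    rw [h3]
    refine le_of_mul_le_mul_left ?_ hn0
    have h6 : (n : ℝ) * (2 * (1 / n * ∫ S, 𝔼 σ : Fin n → ℤˣ, ⨆ i, ∑ j, sgn (σ j) * l i (S j) ∂μ)
        + M * √(2 * Real.log (2 / δ) / n)) =
        2 * (∫ S, 𝔼 σ : Fin n → ℤˣ, ⨆ i, ∑ j, sgn (σ j) * l i (S j) ∂μ) + ε := by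
      rw [h4]
      field_simp
    rw [h5, h6]
    have h7 : m ≤ 2 * ∫ S, 𝔼 σ : Fin n → ℤˣ, ⨆ i, ∑ j, sgn (σ j) * l i (S j) ∂μ := hmU ▸ h2
    have h8 : G S = U S - V S := rfl
    linarith

/-! ### Combinatorics of the labels and unbiasedness of the label loss. -/

theorem mem_qaLabel_self {K : ℕ} (z : Fin K) (q : Finset (Fin K)) : z ∈ qaLabel z q := by
  unfold qaLabel
  split_ifs with h <;> simp [h]

theorem mem_qaLabel_of_ne {K : ℕ} {y z : Fin K} (h : y ≠ z) (q : Finset (Fin K)) :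
    y ∈ qaLabel z q ↔ z ∉ q ∧ y ∉ q := by
  unfold qaLabel
  split_ifs with hz <;> simp [h, hz]

theorem card_qaLabel {K I : ℕ} (z : Fin K) {q : Finset (Fin K)} (hq : q.card = I) :
    (qaLabel z q).card = 1 ∨ (qaLabel z q).card = K - I := by
  unfold qaLabel
  split_ifs
  · simp
  · right; simp [Finset.card_compl, hq]

/-- The number of question sets for which the label contains a given wrong class. -/
theorem card_filter_mem_qaLabel {K : ℕ} (I : ℕ) {y z : Fin K} (h : y ≠ z) :
    ((Finset.powersetCard I (Finset.univ : Finset (Fin K))).filter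
      fun q => y ∈ qaLabel z q).card = (K - 2).choose I := by
  have : (Finset.powersetCard I (Finset.univ : Finset (Fin K))).filter
      (fun q => y ∈ qaLabel z q) = Finset.powersetCard I ({y, z} : Finset (Fin K))ᶜ := by
    ext q
    simp only [Finset.mem_filter, Finset.mem_powersetCard, mem_qaLabel_of_ne h,
      Finset.subset_univ, true_and]
    rw [Finset.subset_compl_comm]
    simp [Finset.insert_subset_iff]
    tauto
  rw [this, Finset.card_powersetCard, Finset.card_compl, Finset.card_pair h, Fintype.card_fin]

/-- The quotient of the two binomial coefficients is the probability that a given wrong class lies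
in the label. For `I = K - 1` both sides vanish. -/
theorem choose_sub_two_mul {K I : ℕ} (hI : 1 ≤ I) (hIK : I < K) :
    ((K - 2).choose I : ℝ) * (K * (K - 1)) = K.choose I * ((K - I) * (K - I - 1)) := by
  obtain ⟨k, rfl⟩ : ∃ k, K = k + 2 := ⟨K - 2, by omega⟩
  have h1 := Nat.choose_mul_succ_eq k I
  have h2 := Nat.choose_mul_succ_eq (k + 1) I
  have h1' : (k.choose I : ℝ) * (k + 1) = (k + 1).choose I * (k + 1 - I) := by
    have : ((k + 1 - I : ℕ) : ℝ) = k + 1 - I := by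
      rw [Nat.cast_sub (by omega)]; push_cast; ring
    rw [← this]; exact_mod_cast h1
  have h2' : ((k + 1).choose I : ℝ) * (k + 2) = (k + 2).choose I * (k + 2 - I) := by
    have : ((k + 1 + 1 - I : ℕ) : ℝ) = k + 2 - I := by
      rw [Nat.cast_sub (by omega)]; push_cast; ring
    rw [← this]; exact_mod_cast h2
  rw [Nat.add_sub_cancel]
  push_cast
  linear_combination (k + 2 : ℝ) * h1' + (k + 1 - I : ℝ) * h2'

/-- The weight of the classes outside of the label in `qaLoss`. -/
noncomputable def outsideWeight (K I : ℕ) : ℝ :=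
  ((K : ℝ) - I) * ((K : ℝ) - I - 1) / ((I : ℝ) * (2 * (K : ℝ) - I - 1))

theorem denom_pos {K I : ℕ} (hI : 1 ≤ I) (hIK : I < K) :
    (0 : ℝ) < (I : ℝ) * (2 * (K : ℝ) - I - 1) := by
  have h1 : (1 : ℝ) ≤ I := by exact_mod_cast hI
  have h2 : (I : ℝ) + 1 ≤ K := by exact_mod_cast hIK
  exact mul_pos (by linarith) (by linarith)

theorem outsideWeight_nonneg {K I : ℕ} (hI : 1 ≤ I) (hIK : I < K) : 0 ≤ outsideWeight K I := by
  have h2 : (I : ℝ) + 1 ≤ K := by exact_mod_cast hIK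
  exact div_nonneg (mul_nonneg (by linarith) (by linarith)) (denom_pos hI hIK).le

theorem qaLoss_eq_sum_ite {K : ℕ} (I : ℕ) (L : EuclideanSpace ℝ (Fin K) → Fin K → ℝ)
    (v : EuclideanSpace ℝ (Fin K)) (s : Finset (Fin K)) :
    qaLoss I L v s = ∑ y, (if y ∈ s then 1 else -outsideWeight K I) * L v y := by
  rw [qaLoss, ← Finset.sum_add_sum_compl s, sub_eq_add_neg]
  congr 1
  · exact Finset.sum_congr rfl fun y hy => by simp [hy]
  · rw [← neg_mul, Finset.mul_sum]
    refine Finset.sum_congr rfl fun y hy => ?_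
    rw [if_neg (Finset.mem_compl.1 hy)]
    rfl

/-- The loss on Q&A labels is an unbiased estimate of the ordinary loss. -/
theorem sum_qaLoss_qaLabel {K I : ℕ} (hI : 1 ≤ I) (hIK : I < K)
    (L : EuclideanSpace ℝ (Fin K) → Fin K → ℝ) (v : EuclideanSpace ℝ (Fin K)) (z : Fin K) :
    ∑ q ∈ Finset.powersetCard I Finset.univ, qaLoss I L v (qaLabel z q) =
      K.choose I * L v z := by
  simp_rw [qaLoss_eq_sum_ite]
  rw [Finset.sum_comm, Finset.sum_eq_single z]
  · simp [mem_qaLabel_self]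
  · intro y _ hy
    rw [← Finset.sum_mul]
    have hsum : ∑ q ∈ Finset.powersetCard I (Finset.univ : Finset (Fin K)),
        (if y ∈ qaLabel z q then 1 else -outsideWeight K I) =
        ∑ q ∈ Finset.powersetCard I (Finset.univ : Finset (Fin K)),
        ((1 + outsideWeight K I) * (if y ∈ qaLabel z q then 1 else 0) - outsideWeight K I) :=
      Finset.sum_congr rfl fun q _ => by split_ifs <;> ring
    have hD := (denom_pos hI hIK).ne'
    -- This is p - w(1-p) = 0 multiplied by the number of question sets, where w is the outside
    -- weight; it rests on K(K-1) - (K-I)(K-I-1) = I(2K-I-1).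
    have key : (1 + outsideWeight K I) * ((K - 2).choose I : ℝ) -
        K.choose I * outsideWeight K I = 0 := by
      have h := choose_sub_two_mul hI hIK
      have h1 : outsideWeight K I * ((I : ℝ) * (2 * (K : ℝ) - I - 1)) =
        ((K : ℝ) - I) * ((K : ℝ) - I - 1) := div_mul_cancel₀ _ hD
      refine (mul_eq_zero.1 (?_ : _ * ((I : ℝ) * (2 * (K : ℝ) - I - 1)) = 0)).resolve_right hD
      linear_combination h + (((K - 2).choose I : ℝ) - K.choose I) * h1
    rw [hsum, Finset.sum_sub_distrib, ← Finset.mul_sum, Finset.sum_boole,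
      card_filter_mem_qaLabel I hy]
    simp only [Finset.sum_const, Finset.card_powersetCard, Finset.card_univ, Fintype.card_fin,
      nsmul_eq_mul]
    rw [key, zero_mul]
  · simp

theorem choose_cast_pos {K I : ℕ} (hIK : I < K) : (0 : ℝ) < K.choose I := by
  exact_mod_cast Nat.choose_pos hIK.le

/-- By unbiasedness the ordinary loss is an average of label losses at labels that occur, and an
average of ρ-Lipschitz functions is ρ-Lipschitz. The continuity serves for limits of risks, the
Lipschitz bound for the finiteness of `lossSup`. -/
theorem lipschitzWith_loss {K I : ℕ} (hI : 1 ≤ I) (hIK : I < K)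
    {L : EuclideanSpace ℝ (Fin K) → Fin K → ℝ} {ρ : ℝ≥0}
    (hρ : ∀ s : Finset (Fin K), s.card = 1 ∨ s.card = K - I →
      LipschitzWith ρ (fun v => qaLoss I L v s)) (z : Fin K) :
    LipschitzWith ρ (fun v => L v z) := by
  refine LipschitzWith.of_dist_le_mul fun v w => ?_
  rw [Real.dist_eq]
  have hC := choose_cast_pos hIK
  refine le_of_mul_le_mul_left ?_ hC
  rw [← abs_of_pos hC, ← abs_mul, mul_sub, abs_of_pos hC, ← sum_qaLoss_qaLabel hI hIK L v z,
    ← sum_qaLoss_qaLabel hI hIK L w z, ← Finset.sum_sub_distrib]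
  refine (Finset.abs_sum_le_sum_abs _ _).trans ?_
  refine (Finset.sum_le_card_nsmul _ _ (ρ * dist v w) fun q hq => ?_).trans_eq ?_
  · have := (hρ _ (card_qaLabel z (Finset.mem_powersetCard.1 hq).2)).dist_le_mul v w
    rwa [Real.dist_eq] at this
  · simp

/-! ### The law of labelled samples. -/

theorem measurable_qaLabel_map {𝒳 : Type*} [MeasurableSpace 𝒳] {K : ℕ} :
    Measurable fun t : (𝒳 × Fin K) × Finset (Fin K) => (t.1.1, qaLabel t.1.2 t.2) := by
  refine (measurable_fst.comp measurable_fst).prodMk ?_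
  have h : Measurable fun p : Fin K × Finset (Fin K) => qaLabel p.1 p.2 := .of_discrete
  exact h.comp ((measurable_snd.comp measurable_fst).prodMk measurable_snd)

theorem setOf_card_eq {K I : ℕ} : {q : Finset (Fin K) | q.card = I} =
    (Finset.powersetCard I (Finset.univ : Finset (Fin K)) : Set (Finset (Fin K))) := by
  ext q; simp

theorem isProbabilityMeasure_uniformOn_card {K I : ℕ} (hIK : I < K) :
    IsProbabilityMeasure (uniformOn {q : Finset (Fin K) | q.card = I}) := by
  rw [setOf_card_eq]
  refine isProbabilityMeasure_uniformOn (Finset.finite_toSet _) ?_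
  rw [Finset.coe_nonempty, Finset.powersetCard_nonempty]
  simpa using hIK.le

theorem isProbabilityMeasure_qaLaw {𝒳 : Type*} [MeasurableSpace 𝒳] {K I : ℕ} (hIK : I < K)
    (P : Measure (𝒳 × Fin K)) [IsProbabilityMeasure P] : IsProbabilityMeasure (qaLaw P I) := by
  have := isProbabilityMeasure_uniformOn_card hIK
  exact Measure.isProbabilityMeasure_map measurable_qaLabel_map.aemeasurable

theorem integral_uniformOn_card {K I : ℕ} (g : Finset (Fin K) → ℝ) :
    ∫ q, g q ∂(uniformOn {q : Finset (Fin K) | q.card = I}) =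
      (K.choose I : ℝ)⁻¹ * ∑ q ∈ Finset.powersetCard I Finset.univ, g q := by
  rw [setOf_card_eq, uniformOn, ProbabilityTheory.cond, integral_smul_measure, setIntegral_finset]
  · simp [Measure.count_apply_finset, Measure.real]
  · exact IntegrableOn.of_finite (Finset.finite_toSet _)

theorem ae_uniformOn_card {K I : ℕ} :
    ∀ᵐ q ∂(uniformOn {q : Finset (Fin K) | q.card = I}), q.card = I := by
  rw [uniformOn, ProbabilityTheory.cond]
  exact Measure.ae_smul_measure (ae_restrict_mem (Set.Finite.measurableSet (Set.toFinite _))) _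

theorem measurePreserving_fst_qaLaw {𝒳 : Type*} [MeasurableSpace 𝒳] {K I : ℕ} (hIK : I < K)
    (P : Measure (𝒳 × Fin K)) [IsProbabilityMeasure P] :
    MeasurePreserving Prod.fst (qaLaw P I) (P.map Prod.fst) := by
  have := isProbabilityMeasure_uniformOn_card hIK
  refine ⟨measurable_fst, ?_⟩
  rw [qaLaw, Measure.map_map measurable_fst measurable_qaLabel_map]
  have h := (measurePreserving_fst (μ := P)
    (ν := uniformOn {q : Finset (Fin K) | q.card = I})).map_eq
  conv_rhs => rw [← h]
  rw [Measure.map_map measurable_fst measurable_fst]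
  rfl

theorem ae_qaLaw_card {𝒳 : Type*} [MeasurableSpace 𝒳] {K I : ℕ}
    (P : Measure (𝒳 × Fin K)) [IsProbabilityMeasure P] :
    ∀ᵐ p ∂(qaLaw P I), p.2.card = 1 ∨ p.2.card = K - I := by
  rw [qaLaw, ae_map_iff measurable_qaLabel_map.aemeasurable]
  · have h : ∀ᵐ t ∂(P.prod (uniformOn {q : Finset (Fin K) | q.card = I})), t.2.card = I :=
      Measure.quasiMeasurePreserving_snd.ae ae_uniformOn_card
    filter_upwards [h] with t ht using card_qaLabel _ ht
  · exact measurable_snd (MeasurableSet.of_discrete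
      (s := {s : Finset (Fin K) | s.card = 1 ∨ s.card = K - I}))

/-! ### Range, Lipschitz constant and mean of the sample loss. -/

/-- The loss of a hypothesis on a Q&A-labelled instance, replaced by `0` on the labels that do
not occur. -/
noncomputable def sampleLoss {𝒳 : Type*} {K : ℕ} (I : ℕ)
    (L : EuclideanSpace ℝ (Fin K) → Fin K → ℝ) (f : 𝒳 → EuclideanSpace ℝ (Fin K))
    (p : 𝒳 × Finset (Fin K)) : ℝ :=
  if p.2.card = 1 ∨ p.2.card = K - I then qaLoss I L (f p.1) p.2 else 0

theorem measurable_sampleLoss {𝒳 : Type*} [MeasurableSpace 𝒳] {K I : ℕ}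
    {L : EuclideanSpace ℝ (Fin K) → Fin K → ℝ} {ρ : ℝ≥0}
    (hρ : ∀ s : Finset (Fin K), s.card = 1 ∨ s.card = K - I →
      LipschitzWith ρ (fun v => qaLoss I L v s))
    {f : 𝒳 → EuclideanSpace ℝ (Fin K)} (hf : Measurable f) : Measurable (sampleLoss I L f) := by
  refine measurable_from_prod_countable_left fun s => ?_
  by_cases hs : s.card = 1 ∨ s.card = K - I
  · simp only [sampleLoss, hs, if_true]
    exact (hρ s hs).continuous.measurable.comp hf
  · simp only [sampleLoss, hs, if_false, measurable_const]

/-- The length of the range of `qaLoss` for a loss with values in `[0, 1]`. -/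
noncomputable def rangeLength (K I : ℕ) : ℝ :=
  ((K : ℝ) - I) * ((K : ℝ) ^ 2 + ((I : ℝ) - 2) * (K : ℝ) - (I : ℝ) ^ 2 + 1)
    / ((I : ℝ) * (2 * (K : ℝ) - I - 1))

theorem rangeLength_eq {K I : ℕ} (hI : 1 ≤ I) (hIK : I < K) :
    rangeLength K I = outsideWeight K I * (K - 1) + (K - I) := by
  have hD := (denom_pos hI hIK).ne'
  rw [rangeLength, outsideWeight, div_mul_eq_mul_div, div_add' _ _ _ hD]
  congr 1
  ring

theorem rangeLength_pos {K I : ℕ} (hI : 1 ≤ I) (hIK : I < K) : 0 < rangeLength K I := by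
  have h1 : (1 : ℝ) ≤ I := by exact_mod_cast hI
  have h2 : (I : ℝ) + 1 ≤ K := by exact_mod_cast hIK
  rw [rangeLength_eq hI hIK]
  have := mul_nonneg (outsideWeight_nonneg hI hIK) (by linarith : (0 : ℝ) ≤ K - 1)
  linarith

/-- A label that occurs has between 1 and K-I elements, so the inside sum is at most (K-I)C and the
outside sum at most (K-1)C. At other labels the value 0 lies in the same interval, so the bound
holds everywhere, as the bounded differences argument requires. -/
theorem sampleLoss_mem_Icc {𝒳 : Type*} {K I : ℕ} (hI : 1 ≤ I) (hIK : I < K)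
    {L : EuclideanSpace ℝ (Fin K) → Fin K → ℝ} (hL : ∀ v y, 0 ≤ L v y)
    {f : 𝒳 → EuclideanSpace ℝ (Fin K)} {C : ℝ} (hC : 0 ≤ C) (hfC : ∀ x y, L (f x) y ≤ C)
    (p : 𝒳 × Finset (Fin K)) :
    sampleLoss I L f p ∈ Set.Icc (-(outsideWeight K I * (K - 1) * C))
      (-(outsideWeight K I * (K - 1) * C) + rangeLength K I * C) := by
  have h1 : (1 : ℝ) ≤ I := by exact_mod_cast hI
  have h2 : (I : ℝ) + 1 ≤ K := by exact_mod_cast hIK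
  have hw := outsideWeight_nonneg hI hIK
  have hub : -(outsideWeight K I * (K - 1) * C) + rangeLength K I * C = (K - I) * C := by
    rw [rangeLength_eq hI hIK]; ring
  rw [hub]
  have hlow : 0 ≤ outsideWeight K I * (K - 1) * C :=
    mul_nonneg (mul_nonneg hw (by linarith)) hC
  have hup : 0 ≤ ((K : ℝ) - I) * C := mul_nonneg (by linarith) hC
  unfold sampleLoss
  split_ifs with hs
  · have hsum : ∀ t : Finset (Fin K), 0 ≤ ∑ y ∈ t, L (f p.1) y ∧
        ∑ y ∈ t, L (f p.1) y ≤ t.card * C := fun t =>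
      ⟨Finset.sum_nonneg fun y _ => hL _ _, by
        simpa using Finset.sum_le_card_nsmul t _ C fun y _ => hfC p.1 y⟩
    have ha := hsum p.2
    have hb := hsum p.2ᶜ
    have hca : (p.2.card : ℝ) ≤ K - I := by
      rcases hs with h | h
      · rw [h]; push_cast; linarith
      · rw [h, Nat.cast_sub hIK.le]
    have hcb : (p.2ᶜ.card : ℝ) ≤ K - 1 := by
      have h3 : 1 ≤ p.2.card := by omega
      have h4 : p.2.card ≤ K := by simpa using Finset.card_le_univ p.2
      rw [Finset.card_compl, Fintype.card_fin, Nat.cast_sub h4]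
      have : (1 : ℝ) ≤ p.2.card := by exact_mod_cast h3
      linarith
    have hq : qaLoss I L (f p.1) p.2 =
        ∑ y ∈ p.2, L (f p.1) y - outsideWeight K I * ∑ y ∈ p.2ᶜ, L (f p.1) y := rfl
    have h5 : outsideWeight K I * ∑ y ∈ p.2ᶜ, L (f p.1) y ≤ outsideWeight K I * ((K - 1) * C) :=
      mul_le_mul_of_nonneg_left (hb.2.trans (mul_le_mul_of_nonneg_right hcb hC)) hw
    have h6 := mul_nonneg hw hb.1
    have h7 := ha.2.trans (mul_le_mul_of_nonneg_right hca hC)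
    rw [hq]
    exact ⟨by linarith [ha.1], by linarith⟩
  · exact ⟨by linarith, by linarith⟩

theorem abs_sampleLoss_sub_le {𝒳 : Type*} {K I : ℕ}
    {L : EuclideanSpace ℝ (Fin K) → Fin K → ℝ} {ρ : ℝ≥0}
    (hρ : ∀ s : Finset (Fin K), s.card = 1 ∨ s.card = K - I →
      LipschitzWith ρ (fun v => qaLoss I L v s))
    (f g : 𝒳 → EuclideanSpace ℝ (Fin K)) (p : 𝒳 × Finset (Fin K)) :
    |sampleLoss I L f p - sampleLoss I L g p| ≤ ρ * ‖f p.1 - g p.1‖ := by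
  unfold sampleLoss
  split_ifs with hs
  · have := (hρ p.2 hs).dist_le_mul (f p.1) (g p.1)
    rwa [Real.dist_eq, dist_eq_norm] at this
  · simp; positivity

/-- The question set is independent of instance and class: by Fubini it is averaged out first, and
`sum_qaLoss_qaLabel` leaves the ordinary loss. -/
theorem integral_sampleLoss {𝒳 : Type*} [MeasurableSpace 𝒳] {K I : ℕ} (hI : 1 ≤ I)
    (hIK : I < K) (P : Measure (𝒳 × Fin K)) [IsProbabilityMeasure P]
    {L : EuclideanSpace ℝ (Fin K) → Fin K → ℝ} (hL : ∀ v y, 0 ≤ L v y) {ρ : ℝ≥0}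
    (hρ : ∀ s : Finset (Fin K), s.card = 1 ∨ s.card = K - I →
      LipschitzWith ρ (fun v => qaLoss I L v s))
    {f : 𝒳 → EuclideanSpace ℝ (Fin K)} (hf : Measurable f) {C : ℝ} (hC : 0 ≤ C)
    (hfC : ∀ x y, L (f x) y ≤ C) :
    ∫ p, sampleLoss I L f p ∂(qaLaw P I) = risk P L f := by
  have := isProbabilityMeasure_uniformOn_card hIK
  have := isProbabilityMeasure_qaLaw hIK P (I := I)
  have hm := measurable_sampleLoss hρ hf
  have hi : Integrable (sampleLoss I L f) (qaLaw P I) :=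
    Integrable.of_mem_Icc _ _ hm.aemeasurable
      (Eventually.of_forall fun p => sampleLoss_mem_Icc hI hIK hL hC hfC p)
  rw [qaLaw, integral_map measurable_qaLabel_map.aemeasurable hm.aestronglyMeasurable,
    integral_prod]
  · rw [risk]
    refine integral_congr_ae (Eventually.of_forall fun p => ?_)
    simp only
    rw [integral_uniformOn_card]
    have h : ∑ q ∈ Finset.powersetCard I (Finset.univ : Finset (Fin K)),
        sampleLoss I L f (p.1, qaLabel p.2 q) = K.choose I * L (f p.1) p.2 := by
      rw [← sum_qaLoss_qaLabel hI hIK]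
      refine Finset.sum_congr rfl fun q hq => ?_
      exact if_pos (card_qaLabel p.2 (Finset.mem_powersetCard.1 hq).2)
    rw [h, inv_mul_cancel_left₀ (choose_cast_pos hIK).ne']
  · exact (integrable_map_measure hm.aestronglyMeasurable
      measurable_qaLabel_map.aemeasurable).1 hi

/-! ### From Rademacher averages of losses to those of discriminant functions. -/

theorem EReal_coe_sum {ι : Type*} (s : Finset ι) (f : ι → ℝ) :
    ((∑ i ∈ s, f i : ℝ) : EReal) = ∑ i ∈ s, (f i : EReal) := by
  classical
  induction s using Finset.induction_on with
  | empty => simp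
  | insert a s ha ih => rw [Finset.sum_insert ha, Finset.sum_insert ha, EReal.coe_add, ih]

theorem ofReal_sum_le {ι : Type*} (s : Finset ι) (f : ι → ℝ) :
    ENNReal.ofReal (∑ i ∈ s, f i) ≤ ∑ i ∈ s, ENNReal.ofReal (f i) :=
  Finset.le_sum_of_subadditive ENNReal.ofReal ENNReal.ofReal_zero.le (fun _ _ => ENNReal.ofReal_add_le)
    s f

theorem coe_expect_sign_eq {n : ℕ} (f : (Fin n → ℤˣ) → ℝ) :
    ((𝔼 σ, f σ : ℝ) : EReal) = (((2 : ℝ) ^ n)⁻¹ : ℝ) * ∑ σ, (f σ : EReal) := by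
  rw [← EReal_coe_sum, ← EReal.coe_mul, Fintype.expect_eq_sum_div_card, div_eq_inv_mul]
  simp

/-- Over a finite family the real supremum is attained, so no default value spoils the comparison
with the extended-real one. -/
theorem coe_expect_iSup_le_empRademacher {𝒳 T : Type*} [Finite T] [Nonempty T] (g : T → 𝒳 → ℝ)
    {H : Set (𝒳 → ℝ)} (hg : ∀ t, g t ∈ H) {n : ℕ} (x : Fin n → 𝒳) :
    ((𝔼 σ : Fin n → ℤˣ, ⨆ t, 1 / (n : ℝ) * ∑ i, sgn (σ i) * g t (x i) : ℝ) : EReal) ≤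
      empRademacher H x := by
  rw [coe_expect_sign_eq, empRademacher]
  refine mul_le_mul_of_nonneg_left (Finset.sum_le_sum fun σ _ => ?_)
    (EReal.coe_nonneg.2 (by positivity))
  obtain ⟨t, ht⟩ := exists_eq_ciSup_of_finite
    (f := fun t => 1 / (n : ℝ) * ∑ i, sgn (σ i) * g t (x i))
  rw [← ht]
  exact le_iSup₂_of_le (g t) (hg t) le_rfl

theorem empRademacher_mono {𝒳 : Type*} {H H' : Set (𝒳 → ℝ)} (h : H ⊆ H') {n : ℕ}
    (x : Fin n → 𝒳) : empRademacher H x ≤ empRademacher H' x :=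
  mul_le_mul_of_nonneg_left (Finset.sum_le_sum fun _ _ => biSup_mono fun _ hi => h hi)
    (EReal.coe_nonneg.2 (by positivity))

theorem rademacher_mono {𝒳 : Type*} [MeasurableSpace 𝒳] (μ : Measure 𝒳) (n : ℕ)
    {H H' : Set (𝒳 → ℝ)} (h : H ⊆ H') : rademacher μ n H ≤ rademacher μ n H' :=
  lintegral_mono fun x => EReal.toENNReal_le_toENNReal (empRademacher_mono h x)

theorem measurable_empRademacher {𝒳 : Type*} [MeasurableSpace 𝒳] {H : Set (𝒳 → ℝ)}
    (hH : H.Countable) (hm : ∀ h ∈ H, Measurable h) (n : ℕ) :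
    Measurable fun x : Fin n → 𝒳 => (empRademacher H x).toENNReal := by
  refine Measurable.ereal_toENNReal ?_
  refine Measurable.const_mul (Finset.measurable_fun_sum _ fun σ _ => ?_) _
  refine Measurable.biSup H hH fun h hh => Measurable.coe_real_ereal ?_
  exact (Finset.measurable_fun_sum _ fun i _ =>
    ((hm h hh).comp (measurable_pi_apply i)).const_mul _).const_mul _

/-- Contraction: the Rademacher average of the losses is controlled by those of the discriminant
functions. -/
theorem ofReal_expect_sampleLoss_le {𝒳 : Type*} {K I : ℕ}
    {L : EuclideanSpace ℝ (Fin K) → Fin K → ℝ} {ρ : ℝ≥0}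
    (hρ : ∀ s : Finset (Fin K), s.card = 1 ∨ s.card = K - I →
      LipschitzWith ρ (fun v => qaLoss I L v s))
    {F : Set (𝒳 → EuclideanSpace ℝ (Fin K))} (hF : F.Nonempty) {n : ℕ}
    (S : Fin n → 𝒳 × Finset (Fin K)) :
    ENNReal.ofReal (𝔼 σ : Fin n → ℤˣ, ⨆ f : F, 1 / (n : ℝ) * ∑ j,
        sgn (σ j) * sampleLoss I L f (S j)) ≤
      ENNReal.ofReal (ρ * √K) *
        ∑ y, (empRademacher (discriminants F y) fun j => (S j).1).toENNReal := by
  have : Nonempty F := hF.to_subtype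
  set B := ENNReal.ofReal (ρ * √K) *
        ∑ y, (empRademacher (discriminants F y) fun j => (S j).1).toENNReal with hB
  by_cases htop : B = ⊤
  · rw [htop]; exact le_top
  refine (ENNReal.ofReal_le_iff_le_toReal htop).2 ?_
  have hn : (0 : ℝ) ≤ 1 / n := by positivity
  simp_rw [Finset.mul_sum, mul_left_comm (1 / (n : ℝ))]
  -- The factor 1/n goes into both the losses and the vectors, so the Lipschitz constant stays `ρ`.
  refine expect_iSup_le_of_forall_expect_iSup_le (T := F) (ρ : ℝ) ρ.2 n
    (fun j f => 1 / (n : ℝ) * sampleLoss I L f (S j))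
    (fun j f => (1 / (n : ℝ)) • (f : 𝒳 → EuclideanSpace ℝ (Fin K)) (S j).1)
    (fun j f g => ?_) _ fun T' hT' hne => ?_
  · rw [← mul_sub, ← smul_sub, abs_mul, norm_smul, abs_of_nonneg hn, Real.norm_of_nonneg hn,
      mul_left_comm]
    exact mul_le_mul_of_nonneg_left (abs_sampleLoss_sub_le hρ f g (S j)) hn
  · have : Finite T' := hT'
    have : Nonempty T' := hne.to_subtype
    refine (ENNReal.ofReal_le_iff_le_toReal htop).1 ?_
    rw [ENNReal.ofReal_mul (by positivity)]
    refine mul_le_mul_right ?_ _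
    refine (ofReal_sum_le _ _).trans (Finset.sum_le_sum fun y _ => ?_)
    have h := coe_expect_iSup_le_empRademacher
      (fun (t : T') x => (t : 𝒳 → EuclideanSpace ℝ (Fin K)) x y)
      (H := discriminants F y) (fun t => ⟨t, t.1.2, rfl⟩) (fun j => (S j).1)
    have h' := EReal.toENNReal_le_toENNReal h
    rw [EReal.toENNReal_of_ne_top (EReal.coe_ne_top _), EReal.toReal_coe] at h'
    refine le_trans (le_of_eq ?_) h'
    congr 1
    refine Finset.expect_congr rfl fun σ _ => iSup_congr fun t => ?_
    rw [Finset.mul_sum]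
    refine Finset.sum_congr rfl fun j _ => ?_
    simp only [PiLp.smul_apply, smul_eq_mul]
    ring

/-- If `f` is not integrable, its Bochner integral is 0 and the bound is trivial. -/
theorem ofReal_integral_le_lintegral {Ω : Type*} [MeasurableSpace Ω] {μ : Measure Ω}
    (f : Ω → ℝ) : ENNReal.ofReal (∫ ω, f ω ∂μ) ≤ ∫⁻ ω, ENNReal.ofReal (f ω) ∂μ := by
  by_cases hf : Integrable f μ
  · rw [integral_eq_lintegral_pos_part_sub_lintegral_neg_part hf]
    exact (ENNReal.ofReal_le_ofReal (sub_le_self _ ENNReal.toReal_nonneg)).trans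
      ENNReal.ofReal_toReal_le
  · simp [integral_undef hf]

/-- After contraction only the instances remain, and they are i.i.d. with the marginal of `P`.
Countability makes the empirical complexities measurable, as the change of variables and the sum of
integrals demand. -/
theorem ofReal_integral_sampleLoss_le {𝒳 : Type*} [MeasurableSpace 𝒳] {K I : ℕ} (hIK : I < K)
    (P : Measure (𝒳 × Fin K)) [IsProbabilityMeasure P]
    {L : EuclideanSpace ℝ (Fin K) → Fin K → ℝ} {ρ : ℝ≥0}
    (hρ : ∀ s : Finset (Fin K), s.card = 1 ∨ s.card = K - I →
      LipschitzWith ρ (fun v => qaLoss I L v s))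
    {F : Set (𝒳 → EuclideanSpace ℝ (Fin K))} (hF : F.Nonempty) (hFc : F.Countable)
    (hFm : ∀ f ∈ F, Measurable f) (n : ℕ) :
    ENNReal.ofReal (∫ S, 𝔼 σ : Fin n → ℤˣ, ⨆ f : F, 1 / (n : ℝ) * ∑ j,
        sgn (σ j) * sampleLoss I L f (S j) ∂(sampleLaw P I n)) ≤
      ENNReal.ofReal (ρ * √K) * ∑ y, rademacher (P.map Prod.fst) n (discriminants F y) := by
  have := isProbabilityMeasure_qaLaw hIK P (I := I)
  have : IsProbabilityMeasure (P.map Prod.fst) :=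
    Measure.isProbabilityMeasure_map measurable_fst.aemeasurable
  have hmp : MeasurePreserving (fun (S : Fin n → 𝒳 × Finset (Fin K)) j => (S j).1)
      (sampleLaw P I n) (Measure.pi fun _ => P.map Prod.fst) :=
    measurePreserving_pi _ _ fun _ => measurePreserving_fst_qaLaw hIK P
  have hm : ∀ y, Measurable fun x : Fin n → 𝒳 =>
      (empRademacher (discriminants F y) x).toENNReal := fun y => by
    refine measurable_empRademacher ?_ ?_ n
    · have : discriminants F y = (fun (f : 𝒳 → EuclideanSpace ℝ (Fin K)) x => f x y) '' F := by
        ext g; simp [discriminants, eq_comm]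
      rw [this]
      exact hFc.image _
    · rintro _ ⟨f, hf, rfl⟩
      have := hFm f hf
      fun_prop
  calc _ ≤ ∫⁻ S, ENNReal.ofReal (𝔼 σ : Fin n → ℤˣ, ⨆ f : F, 1 / (n : ℝ) * ∑ j,
        sgn (σ j) * sampleLoss I L f (S j)) ∂(sampleLaw P I n) := ofReal_integral_le_lintegral _
    _ ≤ ∫⁻ S, ENNReal.ofReal (ρ * √K) *
        ∑ y, (empRademacher (discriminants F y) fun j => (S j).1).toENNReal
          ∂(sampleLaw P I n) := lintegral_mono fun S => ofReal_expect_sampleLoss_le hρ hF S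
    _ = ENNReal.ofReal (ρ * √K) * ∑ y, rademacher (P.map Prod.fst) n (discriminants F y) := by
        rw [lintegral_const_mul' _ _ ENNReal.ofReal_ne_top]
        congr 1
        refine (lintegral_finsetSum _ fun y _ => (hm y).comp hmp.measurable).trans ?_
        exact Finset.sum_congr rfl fun y _ => hmp.lintegral_comp (hm y)

/-! ### The excess risk bound. -/

theorem isProbabilityMeasure_sampleLaw {𝒳 : Type*} [MeasurableSpace 𝒳] {K I : ℕ} (hIK : I < K)
    (P : Measure (𝒳 × Fin K)) [IsProbabilityMeasure P] (n : ℕ) :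
    IsProbabilityMeasure (sampleLaw P I n) := by
  have := isProbabilityMeasure_qaLaw hIK P (I := I)
  unfold sampleLaw
  infer_instance

theorem loss_le_toReal_lossSup {𝒳 : Type*} {K : ℕ} {L : EuclideanSpace ℝ (Fin K) → Fin K → ℝ}
    {F : Set (𝒳 → EuclideanSpace ℝ (Fin K))} (h : lossSup L F ≠ ⊤)
    {f : 𝒳 → EuclideanSpace ℝ (Fin K)} (hf : f ∈ F) (x : 𝒳) (y : Fin K) :
    L (f x) y ≤ (lossSup L F).toReal := by
  refine (ENNReal.ofReal_le_iff_le_toReal h).1 ?_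
  exact le_iSup₂_of_le f hf (le_iSup₂_of_le x y le_rfl)

theorem tendsto_risk {𝒳 : Type*} [MeasurableSpace 𝒳] {K : ℕ}
    (P : Measure (𝒳 × Fin K)) [IsProbabilityMeasure P]
    {L : EuclideanSpace ℝ (Fin K) → Fin K → ℝ} (hL : ∀ v y, 0 ≤ L v y)
    (hLc : ∀ y, Continuous fun v => L v y)
    {u : ℕ → 𝒳 → EuclideanSpace ℝ (Fin K)} {f : 𝒳 → EuclideanSpace ℝ (Fin K)}
    (hu : ∀ k, Measurable (u k)) {C : ℝ} (hC : ∀ k x y, L (u k x) y ≤ C)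
    (hlim : ∀ x, Tendsto (fun k => u k x) atTop (𝓝 (f x))) :
    Tendsto (fun k => risk P L (u k)) atTop (𝓝 (risk P L f)) := by
  refine tendsto_integral_of_dominated_convergence (fun _ => C) (fun k => ?_)
    (integrable_const C) (fun k => Eventually.of_forall fun p => ?_)
    (Eventually.of_forall fun p => ?_)
  · exact (measurable_from_prod_countable_left fun y =>
      (hLc y).measurable.comp (hu k)).aestronglyMeasurable
  · rw [Real.norm_of_nonneg (hL _ _)]
    exact hC k _ _
  · exact ((hLc p.2).tendsto _).comp (hlim p.1)

theorem ae_sampleLaw_card {𝒳 : Type*} [MeasurableSpace 𝒳] {K I : ℕ} (hIK : I < K)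
    (P : Measure (𝒳 × Fin K)) [IsProbabilityMeasure P] (n : ℕ) :
    ∀ᵐ S ∂(sampleLaw P I n), ∀ j, (S j).2.card = 1 ∨ (S j).2.card = K - I := by
  have := isProbabilityMeasure_qaLaw hIK P (I := I)
  rw [ae_all_iff]
  intro j
  exact (measurePreserving_eval (fun _ : Fin n => qaLaw P I) j).quasiMeasurePreserving.ae
    (ae_qaLaw_card P)

theorem measurableSet_card {𝒳 : Type*} [MeasurableSpace 𝒳] {K I : ℕ} (n : ℕ) :
    MeasurableSet {S : Fin n → 𝒳 × Finset (Fin K) |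
      ∀ j, (S j).2.card = 1 ∨ (S j).2.card = K - I} := by
  rw [Set.ofPred_forall]
  refine MeasurableSet.iInter fun j => ?_
  exact (measurable_snd.comp (measurable_pi_apply j)) (MeasurableSet.of_discrete
      (s := {s : Finset (Fin K) | s.card = 1 ∨ s.card = K - I}))

/-- Excess risk bound for bounded, not identically vanishing losses. -/
theorem exists_excess_risk_le {𝒳 : Type*} [MeasurableSpace 𝒳] {K I : ℕ} (hI : 1 ≤ I) (hIK : I < K)
    (P : Measure (𝒳 × Fin K)) [IsProbabilityMeasure P]
    {L : EuclideanSpace ℝ (Fin K) → Fin K → ℝ} (hL : ∀ v y, 0 ≤ L v y) {ρ : ℝ≥0}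
    (hρ : ∀ s : Finset (Fin K), s.card = 1 ∨ s.card = K - I →
      LipschitzWith ρ (fun v => qaLoss I L v s))
    {F : Set (𝒳 → EuclideanSpace ℝ (Fin K))} (hF : PointwiseMeasurable F)
    {fstar : 𝒳 → EuclideanSpace ℝ (Fin K)} (hfstar : fstar ∈ F)
    {C : ℝ} (hC : 0 < C) (hFC : ∀ f ∈ F, ∀ x y, L (f x) y ≤ C)
    {n : ℕ} (hn : 1 ≤ n) {δ : ℝ} (hδ : 0 < δ) (hδ1 : δ < 1) :
    ∃ A : Set (Fin n → 𝒳 × Finset (Fin K)), MeasurableSet A ∧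
      ENNReal.ofReal (1 - δ) ≤ sampleLaw P I n A ∧
      ∀ S ∈ A, ∀ fhat, IsERM I L F S fhat →
        ENNReal.ofReal (risk P L fhat - risk P L fstar) ≤
          2 * (ENNReal.ofReal (ρ * √K) *
            ∑ y, rademacher (P.map Prod.fst) n (discriminants F y)) +
          ENNReal.ofReal (rangeLength K I * C * √(2 * Real.log (2 / δ) / n)) := by
  have := isProbabilityMeasure_qaLaw hIK P (I := I)
  obtain ⟨hFm, F₀, hF₀, hF₀c, hF₀d⟩ := hF
  -- The comparison hypothesis `fstar` must belong to the countable class.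
  set F₁ := insert fstar F₀ with hF₁
  have hF₁F : F₁ ⊆ F := Set.insert_subset hfstar hF₀
  have hF₁c : F₁.Countable := hF₀c.insert fstar
  have : Countable F₁ := hF₁c.to_subtype
  have hF₁m : ∀ f ∈ F₁, Measurable f := fun f hf => hFm f (hF₁F hf)
  have hint : ∀ f ∈ F, ∫ p, sampleLoss I L f p ∂(qaLaw P I) = risk P L f := fun f hf =>
    integral_sampleLoss hI hIK P hL hρ (hFm f hf) hC.le (hFC f hf)
  obtain ⟨A, hAm, hAδ, hA⟩ := exists_uniform_deviation_bound (qaLaw P I) hn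
    (fun f : F₁ => sampleLoss I L (f : 𝒳 → EuclideanSpace ℝ (Fin K)))
    (fun f => measurable_sampleLoss hρ (hF₁m f f.2)) (mul_pos (rangeLength_pos hI hIK) hC)
    (fun f p => sampleLoss_mem_Icc hI hIK hL hC.le (hFC f (hF₁F f.2)) p)
    ⟨fstar, Set.mem_insert _ _⟩ hδ hδ1
  -- On this event of full measure `sampleLoss` agrees with `qaLoss`, and the empirical risk is
  -- continuous along pointwise limits.
  set Good := {S : Fin n → 𝒳 × Finset (Fin K) |
    ∀ j, (S j).2.card = 1 ∨ (S j).2.card = K - I} with hGood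
  set J := ∫ S, 𝔼 σ : Fin n → ℤˣ, ⨆ f : F₁, 1 / (n : ℝ) * ∑ j, sgn (σ j) * sampleLoss I L f (S j)
    ∂(sampleLaw P I n) with hJ
  refine ⟨A ∩ Good, hAm.inter (measurableSet_card n), ?_, fun S hS fhat hfhat => ?_⟩
  · have : sampleLaw P I n (A ∩ Good) = sampleLaw P I n A := by
      refine measure_congr ?_
      filter_upwards [ae_sampleLaw_card hIK P n] with S hS
      exact propext ⟨fun h => h.1, fun h => ⟨h, hS⟩⟩
    rw [this]
    exact hAδ
  · have hemp : ∀ f : 𝒳 → EuclideanSpace ℝ (Fin K),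
        1 / (n : ℝ) * ∑ j, sampleLoss I L f (S j) = empRisk I L S f := fun f => by
      rw [empRisk]
      congr 1
      exact Finset.sum_congr rfl fun j _ => if_pos (hS.2 j)
    have hbound : ∀ f ∈ F₀, (risk P L f - empRisk I L S f) +
        (empRisk I L S fstar - risk P L fstar) ≤
        2 * J + rangeLength K I * C * √(2 * Real.log (2 / δ) / n) := by
      intro f hf
      have h := hA S hS.1 ⟨f, Set.mem_insert_of_mem _ hf⟩
      simp only [hint f (hF₀ hf), hint fstar hfstar, hemp] at h
      exact h
    -- `fhat` depends on the sample and may lie outside `F₀`. The bound on `A` is uniform over `F₀`,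
    -- so it survives the limit.
    have hlim : (risk P L fhat - empRisk I L S fhat) +
        (empRisk I L S fstar - risk P L fstar) ≤
        2 * J + rangeLength K I * C * √(2 * Real.log (2 / δ) / n) := by
      obtain ⟨u, hu, hul⟩ := hF₀d fhat hfhat.1
      have h1 : Tendsto (fun k => risk P L (u k)) atTop (𝓝 (risk P L fhat)) :=
        tendsto_risk P hL (fun y => (lipschitzWith_loss hI hIK hρ y).continuous)
          (fun k => hFm _ (hF₀ (hu k))) (fun k => hFC _ (hF₀ (hu k))) hul
      have h2 : Tendsto (fun k => empRisk I L S (u k)) atTop (𝓝 (empRisk I L S fhat)) := by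
        unfold empRisk
        refine (tendsto_finsetSum _ fun j _ => ?_).const_mul _
        exact (((hρ _ (hS.2 j)).continuous.tendsto _).comp (hul (S j).1))
      exact le_of_tendsto' ((h1.sub h2).add_const _) fun k => hbound _ (hu k)
    have hmin : empRisk I L S fhat ≤ empRisk I L S fstar := hfhat.2 hfstar
    have hJle := ofReal_integral_sampleLoss_le hIK P hρ ⟨fstar, Set.mem_insert _ _⟩ hF₁c hF₁m n
    have hJle' : ENNReal.ofReal J ≤ ENNReal.ofReal (ρ * √K) *
        ∑ y, rademacher (P.map Prod.fst) n (discriminants F y) := by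
      refine hJle.trans (mul_le_mul_right (Finset.sum_le_sum fun y _ =>
        rademacher_mono _ _ ?_) _)
      rintro _ ⟨f, hf, rfl⟩
      exact ⟨f, hF₁F hf, rfl⟩
    calc ENNReal.ofReal (risk P L fhat - risk P L fstar)
        ≤ ENNReal.ofReal (2 * J + rangeLength K I * C * √(2 * Real.log (2 / δ) / n)) :=
          ENNReal.ofReal_le_ofReal (by linarith)
      _ ≤ ENNReal.ofReal (2 * J) + _ := ENNReal.ofReal_add_le
      _ ≤ _ := by
          rw [ENNReal.ofReal_mul zero_le_two, ENNReal.ofReal_ofNat]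
          gcongr

/-- It suffices that √K ≤ K, I(2K-I-1) ≤ K(K-1) and 2 ≤ 4√2. -/
theorem two_mul_sqrt_card_le {K I : ℕ} (hI : 1 ≤ I) (hIK : I < K) {ρ : ℝ} (hρ : 0 ≤ ρ) :
    2 * (ρ * √K) ≤ 4 * √2 * ρ * (K : ℝ) ^ 2 * ((K : ℝ) - 1)
                / ((I : ℝ) * (2 * (K : ℝ) - I - 1)) := by
  have h1 : (1 : ℝ) ≤ I := by exact_mod_cast hI
  have h2 : (I : ℝ) + 1 ≤ K := by exact_mod_cast hIK
  have hD := denom_pos hI hIK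
  have hs : √(K : ℝ) ≤ K := Real.sqrt_le_iff.2 ⟨by linarith, by nlinarith⟩
  have hs2 : 1 ≤ √(2 : ℝ) := Real.one_le_sqrt.2 (by norm_num)
  have hDK : (I : ℝ) * (2 * (K : ℝ) - I - 1) ≤ K * (K - 1) := by
    nlinarith [mul_nonneg (by linarith : (0 : ℝ) ≤ K - I) (by linarith : (0 : ℝ) ≤ K - I - 1)]
  rw [le_div_iff₀ hD]
  calc 2 * (ρ * √K) * ((I : ℝ) * (2 * (K : ℝ) - I - 1))
      ≤ 2 * (ρ * K) * (K * (K - 1)) := by gcongr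
    _ = 2 * 1 * ρ * (K : ℝ) ^ 2 * (K - 1) := by ring
    _ ≤ 4 * √2 * ρ * (K : ℝ) ^ 2 * ((K : ℝ) - 1) := by
        have : (0 : ℝ) ≤ K - 1 := by linarith
        gcongr
        norm_num

theorem risk_eq_zero_of_lossSup_eq_zero {𝒳 : Type*} [MeasurableSpace 𝒳] {K : ℕ}
    (P : Measure (𝒳 × Fin K)) {L : EuclideanSpace ℝ (Fin K) → Fin K → ℝ} (hL : ∀ v y, 0 ≤ L v y)
    {F : Set (𝒳 → EuclideanSpace ℝ (Fin K))} (h : lossSup L F = 0)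
    {f : 𝒳 → EuclideanSpace ℝ (Fin K)} (hf : f ∈ F) : risk P L f = 0 := by
  refine integral_eq_zero_of_ae (Eventually.of_forall fun p => le_antisymm ?_ (hL _ _))
  have := loss_le_toReal_lossSup (L := L) (by simp [h]) hf p.1 p.2
  simpa [h] using this

/-- The degenerate cases are split off: for δ ≥ 1 the empty event will do, for infinite `lossSup`
the right side is infinite, and for `lossSup` zero, where the range has length 0, all risks vanish.
-/
theorem exists_excess_risk_bound {𝒳 : Type*} [MeasurableSpace 𝒳] {K I : ℕ} (hI : 1 ≤ I)
    (hIK : I < K) (P : Measure (𝒳 × Fin K)) [IsProbabilityMeasure P]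
    {L : EuclideanSpace ℝ (Fin K) → Fin K → ℝ} (hL : ∀ v y, 0 ≤ L v y) {ρ : ℝ≥0}
    (hρ : ∀ s : Finset (Fin K), s.card = 1 ∨ s.card = K - I →
      LipschitzWith ρ (fun v => qaLoss I L v s))
    {F : Set (𝒳 → EuclideanSpace ℝ (Fin K))} (hF : PointwiseMeasurable F)
    {fstar : 𝒳 → EuclideanSpace ℝ (Fin K)} (hfstar : fstar ∈ F)
    {n : ℕ} (hn : 1 ≤ n) {δ : ℝ} (hδ : 0 < δ) :
    ∃ A : Set (Fin n → 𝒳 × Finset (Fin K)), MeasurableSet A ∧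
      ENNReal.ofReal (1 - δ) ≤ sampleLaw P I n A ∧
      ∀ S ∈ A, ∀ fhat, IsERM I L F S fhat →
        ENNReal.ofReal (risk P L fhat - risk P L fstar) ≤
          ENNReal.ofReal (4 * √2 * ρ * (K : ℝ) ^ 2 * ((K : ℝ) - 1)
                / ((I : ℝ) * (2 * (K : ℝ) - I - 1)))
              * ∑ y, rademacher (P.map Prod.fst) n (discriminants F y)
            + ENNReal.ofReal (rangeLength K I) * lossSup L F
              * ENNReal.ofReal √(2 * Real.log (2 / δ) / (n : ℝ)) := by
  have := isProbabilityMeasure_sampleLaw hIK P (I := I) n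
  rcases le_or_gt 1 δ with hδ1 | hδ1
  · refine ⟨∅, MeasurableSet.empty, ?_, by simp⟩
    rw [ENNReal.ofReal_of_nonpos (by linarith)]
    exact zero_le
  have hone : ENNReal.ofReal (1 - δ) ≤ sampleLaw P I n Set.univ := by
    rw [measure_univ, ← ENNReal.ofReal_one]
    exact ENNReal.ofReal_le_ofReal (by linarith)
  have hlog : 0 < Real.log (2 / δ) := Real.log_pos (by rw [lt_div_iff₀ hδ]; linarith)
  have hn0 : (0 : ℝ) < n := by exact_mod_cast hn
  have hsqrt : 0 < √(2 * Real.log (2 / δ) / (n : ℝ)) := Real.sqrt_pos.2 (by positivity)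
  by_cases htop : lossSup L F = ⊤
  · refine ⟨Set.univ, MeasurableSet.univ, hone, fun S _ fhat _ => ?_⟩
    -- Both other factors must be positive, since ∞ · 0 = 0 in `ℝ≥0∞`.
    rw [htop, ENNReal.mul_top (ENNReal.ofReal_pos.2 (rangeLength_pos hI hIK)).ne',
      ENNReal.top_mul (ENNReal.ofReal_pos.2 hsqrt).ne', add_top]
    exact le_top
  by_cases hzero : lossSup L F = 0
  · refine ⟨Set.univ, MeasurableSet.univ, hone, fun S _ fhat hfhat => ?_⟩
    rw [risk_eq_zero_of_lossSup_eq_zero P hL hzero hfstar,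
      risk_eq_zero_of_lossSup_eq_zero P hL hzero hfhat.1]
    simp
  obtain ⟨A, hAm, hAδ, hA⟩ := exists_excess_risk_le hI hIK P hL hρ hF hfstar
    (ENNReal.toReal_pos hzero htop) (fun f hf => loss_le_toReal_lossSup htop hf) hn hδ hδ1
  refine ⟨A, hAm, hAδ, fun S hS fhat hfhat => (hA S hS fhat hfhat).trans (add_le_add ?_ ?_)⟩
  · rw [← mul_assoc, ← ENNReal.ofReal_ofNat, ← ENNReal.ofReal_mul (by norm_num)]
    gcongr
    exact two_mul_sqrt_card_le hI hIK ρ.2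
  · rw [ENNReal.ofReal_mul (mul_nonneg (rangeLength_pos hI hIK).le ENNReal.toReal_nonneg),
      ENNReal.ofReal_mul (rangeLength_pos hI hIK).le, ENNReal.ofReal_toReal htop]

/-! ### Linear models in a Hilbert space. -/

/-- Averaging over one sign is the parallelogram law; the free vector `a` collects the remaining
terms in the induction. -/
theorem expect_norm_add_sum_sq {H : Type*} [NormedAddCommGroup H] [InnerProductSpace ℝ H] {n : ℕ}
    (a : H) (φ : Fin n → H) :
    𝔼 σ : Fin n → ℤˣ, ‖a + ∑ i, sgn (σ i) • φ i‖ ^ 2 = ‖a‖ ^ 2 + ∑ i, ‖φ i‖ ^ 2 := by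
  induction n generalizing a with
  | zero => simp
  | succ n ih =>
    rw [expect_pi_fin_succ]
    have h : ∀ s : ℤˣ, 𝔼 σ : Fin n → ℤˣ,
        ‖a + ∑ i, sgn ((Fin.cons s σ : Fin (n + 1) → ℤˣ) i) • φ i‖ ^ 2 =
        ‖a + sgn s • φ 0‖ ^ 2 + ∑ i : Fin n, ‖φ i.succ‖ ^ 2 := fun s => by
      rw [← ih]
      simp [Fin.sum_univ_succ, add_assoc]
    simp_rw [h]
    rw [expect_units_int, Fin.sum_univ_succ]
    have hp := parallelogram_law_with_norm ℝ a (φ 0)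
    simp only [sgn_one, sgn_neg, one_smul, neg_smul, ← sub_eq_add_neg]
    linear_combination hp / 2

theorem sq_expect_le_expect_sq {ι : Type*} [Fintype ι] [Nonempty ι] (f : ι → ℝ) :
    (𝔼 i, f i) ^ 2 ≤ 𝔼 i, f i ^ 2 := by
  rw [Fintype.expect_eq_sum_div_card, Fintype.expect_eq_sum_div_card, div_pow]
  have hc : (0 : ℝ) < Fintype.card ι := by exact_mod_cast Fintype.card_pos
  rw [div_le_div_iff₀ (by positivity) hc]
  have := sq_sum_le_card_mul_sum_sq (s := Finset.univ) (f := f)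
  rw [Finset.card_univ] at this
  nlinarith

theorem expect_norm_sum_le {H : Type*} [NormedAddCommGroup H] [InnerProductSpace ℝ H] {n : ℕ}
    {r : ℝ} (hr : 0 ≤ r) (φ : Fin n → H) (hφ : ∀ i, ‖φ i‖ ≤ r) :
    𝔼 σ : Fin n → ℤˣ, ‖∑ i, sgn (σ i) • φ i‖ ≤ √n * r := by
  refine abs_le_of_sq_le_sq' ?_ (by positivity) |>.2
  refine (sq_expect_le_expect_sq _).trans ?_
  have h := expect_norm_add_sum_sq 0 φ
  simp only [zero_add, norm_zero] at h
  rw [h, mul_pow, Real.sq_sqrt (Nat.cast_nonneg n)]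
  calc (0 : ℝ) ^ 2 + ∑ i, ‖φ i‖ ^ 2 ≤ 0 ^ 2 + ∑ _i : Fin n, r ^ 2 := by
        gcongr with i; exact hφ i
    _ = n * r ^ 2 := by simp

/-- By Cauchy–Schwarz the supremum over the ball is at most Λ times the norm of the signed sum of
features, whose mean is at most r√n. -/
theorem empRademacher_linearModel_le {𝒳 H : Type*} [NormedAddCommGroup H] [InnerProductSpace ℝ H]
    {Φ : 𝒳 → H} {r Λ : ℝ} (hr : 0 ≤ r) (hΛ : 0 ≤ Λ) (hΦ : ∀ x, ‖Φ x‖ ≤ r) {n : ℕ} (hn : 1 ≤ n)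
    (x : Fin n → 𝒳) : empRademacher (linearModel Φ Λ) x ≤ ((r * Λ / √n : ℝ) : EReal) := by
  have hn0 : (0 : ℝ) < n := by exact_mod_cast hn
  have h1 : empRademacher (linearModel Φ Λ) x ≤
      ((𝔼 σ : Fin n → ℤˣ, 1 / (n : ℝ) * (Λ * ‖∑ i, sgn (σ i) • Φ (x i)‖) : ℝ) : EReal) := by
    rw [coe_expect_sign_eq, empRademacher]
    refine mul_le_mul_of_nonneg_left (Finset.sum_le_sum fun σ _ => ?_)
      (EReal.coe_nonneg.2 (by positivity))
    refine iSup₂_le ?_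
    rintro _ ⟨w, hw, rfl⟩
    refine EReal.coe_le_coe_iff.2 (mul_le_mul_of_nonneg_left ?_ (by positivity))
    have h2 : ∑ i, sgn (σ i) * inner ℝ w (Φ (x i)) = inner ℝ w (∑ i, sgn (σ i) • Φ (x i)) := by
      rw [inner_sum]
      exact Finset.sum_congr rfl fun i _ => (inner_smul_right _ _ _).symm
    refine h2.le.trans ((real_inner_le_norm _ _).trans ?_)
    gcongr
  refine h1.trans (EReal.coe_le_coe_iff.2 ?_)
  rw [← Finset.mul_expect, ← Finset.mul_expect]
  calc 1 / (n : ℝ) * (Λ * 𝔼 σ : Fin n → ℤˣ, ‖∑ i, sgn (σ i) • Φ (x i)‖)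
      ≤ 1 / (n : ℝ) * (Λ * (√n * r)) := by
        gcongr
        exact expect_norm_sum_le hr _ fun i => hΦ _
    _ = r * Λ / √n := by
        have hs : √(n : ℝ) ≠ 0 := (Real.sqrt_pos.2 hn0).ne'
        have hs2 : √(n : ℝ) ^ 2 = n := Real.sq_sqrt hn0.le
        field_simp
        rw [hs2]
        ring

theorem rademacher_linearModel_le {𝒳 H : Type*} [MeasurableSpace 𝒳] [NormedAddCommGroup H]
    [InnerProductSpace ℝ H] (μ : Measure 𝒳) [IsProbabilityMeasure μ]
    {Φ : 𝒳 → H} {r Λ : ℝ} (hr : 0 ≤ r) (hΛ : 0 ≤ Λ) (hΦ : ∀ x, ‖Φ x‖ ≤ r) {n : ℕ} (hn : 1 ≤ n) :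
    rademacher μ n (linearModel Φ Λ) ≤ ENNReal.ofReal (r * Λ / √n) := by
  calc rademacher μ n (linearModel Φ Λ)
      ≤ ∫⁻ _, ENNReal.ofReal (r * Λ / √n) ∂(Measure.pi fun _ : Fin n => μ) :=
        lintegral_mono fun x =>
          EReal.toENNReal_le_toENNReal (empRademacher_linearModel_le hr hΛ hΦ hn x)
    _ = _ := by simp

/-- All coordinates of hypotheses are bounded by Λr, so their values stay in a fixed ball, on which
a Lipschitz loss is bounded. -/
theorem lossSup_ne_top {𝒳 H : Type*} [NormedAddCommGroup H] [InnerProductSpace ℝ H] {K : ℕ}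
    {L : EuclideanSpace ℝ (Fin K) → Fin K → ℝ} {ρ : ℝ≥0}
    (hL : ∀ y, LipschitzWith ρ fun v => L v y) {F : Set (𝒳 → EuclideanSpace ℝ (Fin K))}
    {Φ : 𝒳 → H} {r Λ : ℝ} (hΛ : 0 ≤ Λ) (hΦ : ∀ x, ‖Φ x‖ ≤ r)
    (hF : ∀ y, discriminants F y = linearModel Φ Λ) : lossSup L F ≠ ⊤ := by
  have hbound : ∀ f ∈ F, ∀ x y, L (f x) y ≤ (∑ y, |L 0 y|) + ρ * √(∑ _i : Fin K, (Λ * r) ^ 2) := by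
    intro f hf x y
    have hcoord : ∀ i, ‖f x i‖ ≤ Λ * r := fun i => by
      have hmem : (fun x => f x i) ∈ discriminants F i := ⟨f, hf, rfl⟩
      rw [hF i] at hmem
      obtain ⟨w, hw, h⟩ := hmem
      rw [show f x i = inner ℝ w (Φ x) from congrFun h x]
      exact (norm_inner_le_norm _ _).trans (by gcongr; exact hΦ x)
    have hnorm : ‖f x‖ ≤ √(∑ _i : Fin K, (Λ * r) ^ 2) := by
      rw [EuclideanSpace.norm_eq]
      gcongr with i
      exact hcoord i
    have h1 := (hL y).dist_le_mul (f x) 0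
    rw [Real.dist_eq, dist_zero_right] at h1
    have h2 : |L 0 y| ≤ ∑ y, |L 0 y| :=
      Finset.single_le_sum (f := fun y => |L 0 y|) (fun _ _ => abs_nonneg _) (Finset.mem_univ y)
    have h3 : (ρ : ℝ) * ‖f x‖ ≤ ρ * √(∑ _i : Fin K, (Λ * r) ^ 2) := by gcongr
    linarith [le_abs_self (L (f x) y - L 0 y), le_abs_self (L 0 y)]
  refine ne_top_of_le_ne_top ENNReal.ofReal_ne_top (iSup₂_le fun f hf => iSup₂_le fun x y =>
    ENNReal.ofReal_le_ofReal (hbound f hf x y))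

/-! ### Consistency. -/

theorem tendsto_const_div_sqrt (c : ℝ) :
    Tendsto (fun n : ℕ => c / √(n : ℝ)) atTop (𝓝 0) :=
  (Real.tendsto_sqrt_atTop.comp tendsto_natCast_atTop_atTop).const_div_atTop c

theorem tendsto_excess_risk_bound {K : ℕ} {a b C : ℝ≥0∞} (ha : a ≠ ⊤) (hb : b ≠ ⊤) (hC : C ≠ ⊤)
    (c d : ℝ) : Tendsto (fun n : ℕ => a * ∑ _y : Fin K, ENNReal.ofReal (c / √(n : ℝ)) +
      b * C * ENNReal.ofReal √(d / (n : ℝ))) atTop (𝓝 0) := by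
  have h1 : Tendsto (fun n : ℕ => ENNReal.ofReal (c / √(n : ℝ))) atTop (𝓝 0) := by
    simpa using ENNReal.tendsto_ofReal (tendsto_const_div_sqrt c)
  have h2 : Tendsto (fun n : ℕ => ENNReal.ofReal √(d / (n : ℝ))) atTop (𝓝 0) := by
    have h := (Real.continuous_sqrt.tendsto 0).comp
      (tendsto_natCast_atTop_atTop.const_div_atTop d : Tendsto (fun n : ℕ => d / (n : ℝ)) _ _)
    simpa using ENNReal.tendsto_ofReal h
  have h3 : Tendsto (fun n : ℕ => a * ∑ _y : Fin K, ENNReal.ofReal (c / √(n : ℝ))) atTop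
      (𝓝 (a * ∑ _y : Fin K, 0)) :=
    ENNReal.Tendsto.const_mul (tendsto_finsetSum _ fun _ _ => h1) (Or.inr ha)
  have h4 := ENNReal.Tendsto.const_mul h2 (Or.inr (ENNReal.mul_ne_top hb hC))
  simpa using h3.add h4

/-- Convergence in probability of the risk of empirical risk minimizers, from Rademacher
complexities of order `1 / √n`. -/
theorem tendsto_sampleLaw_excess_risk {𝒳 : Type*} [MeasurableSpace 𝒳] {K I : ℕ} (hI : 1 ≤ I)
    (hIK : I < K) (P : Measure (𝒳 × Fin K)) [IsProbabilityMeasure P]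
    {L : EuclideanSpace ℝ (Fin K) → Fin K → ℝ} (hL : ∀ v y, 0 ≤ L v y) {ρ : ℝ≥0}
    (hρ : ∀ s : Finset (Fin K), s.card = 1 ∨ s.card = K - I →
      LipschitzWith ρ (fun v => qaLoss I L v s))
    {F : Set (𝒳 → EuclideanSpace ℝ (Fin K))} (hF : PointwiseMeasurable F)
    {fstar : 𝒳 → EuclideanSpace ℝ (Fin K)} (hfstar : fstar ∈ F)
    (hmin : IsMinOn (risk P L) F fstar) (hC : lossSup L F ≠ ⊤) {c : ℝ}
    (hR : ∀ n : ℕ, 1 ≤ n → ∀ y : Fin K,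
      rademacher (P.map Prod.fst) n (discriminants F y) ≤ ENNReal.ofReal (c / √(n : ℝ)))
    {ε : ℝ} (hε : 0 < ε) :
    Tendsto (fun n : ℕ => sampleLaw P I n
      {S | ∃ fhat, IsERM I L F S fhat ∧ ε ≤ |risk P L fhat - risk P L fstar|}) atTop (𝓝 0) := by
  rw [ENNReal.tendsto_nhds_zero]
  intro η hη
  obtain ⟨δ, hδ, hδη, hδ1⟩ : ∃ δ : ℝ, 0 < δ ∧ ENNReal.ofReal δ ≤ η ∧ δ < 1 := by
    rcases eq_or_ne η ⊤ with rfl | hη'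
    · exact ⟨1 / 2, by norm_num, le_top, by norm_num⟩
    · have := ENNReal.toReal_pos hη.ne' hη'
      refine ⟨min η.toReal (1 / 2), by positivity, ?_, (min_le_right _ _).trans_lt (by norm_num)⟩
      exact (ENNReal.ofReal_le_ofReal (min_le_left _ _)).trans ENNReal.ofReal_toReal_le
  have hlim := tendsto_excess_risk_bound (K := K) (ENNReal.ofReal_ne_top (r := 4 * √2 * ρ *
    (K : ℝ) ^ 2 * ((K : ℝ) - 1) / ((I : ℝ) * (2 * (K : ℝ) - I - 1))))
    (ENNReal.ofReal_ne_top (r := rangeLength K I)) hC c (2 * Real.log (2 / δ))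
  filter_upwards [hlim.eventually (gt_mem_nhds (ENNReal.ofReal_pos.2 hε)), eventually_ge_atTop 1]
    with n hn hn1
  have := isProbabilityMeasure_sampleLaw hIK P (I := I) n
  obtain ⟨A, hAm, hAδ, hA⟩ := exists_excess_risk_bound hI hIK P hL hρ hF hfstar hn1 hδ
  calc sampleLaw P I n {S | ∃ fhat, IsERM I L F S fhat ∧ ε ≤ |risk P L fhat - risk P L fstar|}
      -- The set of bad samples need not be measurable; for large `n` it is contained in the
      -- complement of the measurable event `A`.
      ≤ sampleLaw P I n Aᶜ := by
        refine measure_mono ?_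
        rintro S ⟨fhat, hfhat, hle⟩ hS
        rw [abs_of_nonneg (sub_nonneg.2 (hmin hfhat.1))] at hle
        refine absurd hn (not_lt.2 ((ENNReal.ofReal_le_ofReal hle).trans
          ((hA S hS fhat hfhat).trans ?_)))
        gcongr with y
        exact hR n hn1 y
    _ = 1 - sampleLaw P I n A := prob_compl_eq_one_sub hAm
    _ ≤ 1 - ENNReal.ofReal (1 - δ) := tsub_le_tsub_left hAδ _
    _ = ENNReal.ofReal δ := by
        rw [← ENNReal.ofReal_one, ← ENNReal.ofReal_sub _ (by linarith)]
        congr 1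
        ring
    _ ≤ η := hδη

end WhichOne

theorem theorem4 {𝒳 : Type*} [MeasurableSpace 𝒳] (K I : ℕ) (hI : 1 ≤ I) (hIK : I < K)
    (P : Measure (𝒳 × Fin K)) [IsProbabilityMeasure P]
    (L : EuclideanSpace ℝ (Fin K) → Fin K → ℝ) (hL : ∀ v y, 0 ≤ L v y)
    (ρ : ℝ≥0)
    (hρ : ∀ s : Finset (Fin K), s.card = 1 ∨ s.card = K - I →
      LipschitzWith ρ (fun v => WhichOne.qaLoss I L v s))
    (F : Set (𝒳 → EuclideanSpace ℝ (Fin K))) (hF : WhichOne.PointwiseMeasurable F)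
    (fstar : 𝒳 → EuclideanSpace ℝ (Fin K)) (hfstar : fstar ∈ F)
    (hmin : IsMinOn (WhichOne.risk P L) F fstar) :
    (∀ n : ℕ, 1 ≤ n → ∀ δ : ℝ, 0 < δ →
      ∃ A : Set (Fin n → 𝒳 × Finset (Fin K)), MeasurableSet A ∧
        ENNReal.ofReal (1 - δ) ≤ WhichOne.sampleLaw P I n A ∧
        ∀ S ∈ A, ∀ fhat, WhichOne.IsERM I L F S fhat →
          ENNReal.ofReal (WhichOne.risk P L fhat - WhichOne.risk P L fstar) ≤
            ENNReal.ofReal (4 * √2 * ρ * (K : ℝ) ^ 2 * ((K : ℝ) - 1)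
                / ((I : ℝ) * (2 * (K : ℝ) - I - 1)))
              * ∑ y : Fin K,
                  WhichOne.rademacher (P.map Prod.fst) n (WhichOne.discriminants F y)
            + ENNReal.ofReal (((K : ℝ) - I)
                  * ((K : ℝ) ^ 2 + ((I : ℝ) - 2) * (K : ℝ) - (I : ℝ) ^ 2 + 1)
                  / ((I : ℝ) * (2 * (K : ℝ) - I - 1)))
              * WhichOne.lossSup L F
              * ENNReal.ofReal √(2 * Real.log (2 / δ) / (n : ℝ))) ∧
    (∀ (H : Type*) [NormedAddCommGroup H] [InnerProductSpace ℝ H] [CompleteSpace H]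
      (k : 𝒳 → 𝒳 → ℝ) (Φ : 𝒳 → H) (r Λ : ℝ),
      (∀ x x', k x x' = inner ℝ (Φ x) (Φ x')) →
      0 ≤ r → IsLUB (Set.range fun x => k x x) (r ^ 2) → 0 ≤ Λ →
      (∀ y, WhichOne.discriminants F y = WhichOne.linearModel Φ Λ) →
      (∀ n : ℕ, 1 ≤ n → ∀ y : Fin K,
        WhichOne.rademacher (P.map Prod.fst) n (WhichOne.discriminants F y) ≤
          ENNReal.ofReal (r * Λ / √(n : ℝ))) ∧
      (∀ ε : ℝ, 0 < ε →
        Tendsto (fun n : ℕ => WhichOne.sampleLaw P I n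
          {S | ∃ fhat, WhichOne.IsERM I L F S fhat ∧
            ε ≤ |WhichOne.risk P L fhat - WhichOne.risk P L fstar|}) atTop (𝓝 0))) := by
  refine ⟨fun n hn δ hδ =>
    WhichOne.exists_excess_risk_bound hI hIK P hL hρ hF hfstar hn hδ, ?_⟩
  intro H _ _ _ k Φ r Λ hk hr hlub hΛ hmodel
  have : IsProbabilityMeasure (P.map Prod.fst) :=
    Measure.isProbabilityMeasure_map measurable_fst.aemeasurable
  have hΦ : ∀ x, ‖Φ x‖ ≤ r := fun x => by
    have h : k x x ≤ r ^ 2 := hlub.1 ⟨x, rfl⟩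
    rw [hk, real_inner_self_eq_norm_sq] at h
    exact abs_le_of_sq_le_sq' h hr |>.2
  have hR : ∀ n : ℕ, 1 ≤ n → ∀ y : Fin K,
      WhichOne.rademacher (P.map Prod.fst) n (WhichOne.discriminants F y) ≤
        ENNReal.ofReal (r * Λ / √(n : ℝ)) := fun n hn y => by
    rw [hmodel y]
    exact WhichOne.rademacher_linearModel_le _ hr hΛ hΦ hn
  exact ⟨hR, fun ε hε => WhichOne.tendsto_sampleLaw_excess_risk hI hIK P hL hρ hF hfstar hmin
    (WhichOne.lossSup_ne_top (WhichOne.lipschitzWith_loss hI hIK hρ) hΛ hΦ hmodel) hR hε⟩
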